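/- Let $G$ be a finite cubic graph (parallel edges are allowed) without bridges. For a triple of 1-factors $M_1,M_2,M_3$ of $G$, not necessarily distinct, consider the number $|E(G)\setminus(M_1\cup M_2\cup M_3)|$ of edges contained in none of them, and let $\mu_3(G)$ be the minimum of this number over all such triples. Given a proper 5-edge-coloring $\phi\colon E(G)\to\{1,\dots,5\}$ (edges with a common end get distinct colors), call an edge $e$ normal if $e$ together with all edges adjacent to it uses exactly 3 or exactly 5 colors in total. Then $G$ has a proper 5-edge-coloring in which at least $|E(G)|-\mu_3(G)$ edges are normal. -/

import Mathlib

open scoped Graph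

namespace Graph

variable {α β : Type*}

/-- The degree of a vertex: the number of incident edges, loops being counted twice. -/
noncomputable def degree (G : Graph α β) (x : α) : ℕ :=
  (G.incidenceSet x).ncard + (G.loopSet x).ncard

/-- Every vertex has degree three. -/
def IsCubic (G : Graph α β) : Prop :=
  ∀ x ∈ V(G), G.degree x = 3

/-- `x` and `y` are joined by a walk of `G`. -/
def Reachable (G : Graph α β) (x y : α) : Prop :=
  Relation.ReflTransGen G.Adj x y

/-- An edge is a bridge if deleting it disconnects its ends from each other. -/
def IsBridge (G : Graph α β) (e : β) : Prop :=
  ∃ x y, G.IsLink e x y ∧ ¬ (G.deleteEdges {e}).Reachable x y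

/-- No edge is a bridge. -/
def Bridgeless (G : Graph α β) : Prop :=
  ∀ e ∈ E(G), ¬ G.IsBridge e

/-- The edge set `M` of a 1-factor: every vertex lies on exactly one edge of `M`, and no edge
of `M` is a loop. -/
structure IsOneFactor (G : Graph α β) (M : Set β) : Prop where
  subset : M ⊆ E(G)
  existsUnique : ∀ x ∈ V(G), ∃! e, e ∈ M ∧ G.Inc e x
  not_isLoopAt : ∀ e ∈ M, ∀ x, ¬ G.IsLoopAt e x

/-- `G` has a `k`-core: some list of three (not necessarily distinct) 1-factors leaves precisely
`k` edges of `G` uncovered. -/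
def HasCore (G : Graph α β) (k : ℕ) : Prop :=
  ∃ M₁ M₂ M₃ : Set β, G.IsOneFactor M₁ ∧ G.IsOneFactor M₂ ∧ G.IsOneFactor M₃ ∧
    (E(G) \ (M₁ ∪ M₂ ∪ M₃)).ncard = k

/-- `μ₃(G)`: the least `k` for which `G` has a `k`-core. -/
noncomputable def mu3 (G : Graph α β) : ℕ :=
  sInf {k | G.HasCore k}

/-- Distinct edges of `G` with a common end receive distinct colors. -/
def IsProperEdgeColoring {C : Type*} (G : Graph α β) (φ : β → C) : Prop :=
  ∀ ⦃e f : β⦄ ⦃x : α⦄, G.Inc e x → G.Inc f x → e ≠ f → φ e ≠ φ f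

/-- The set of colors used by an edge `e` of `G` together with all edges adjacent to it. -/
def colorsAround {C : Type*} (G : Graph α β) (φ : β → C) (e : β) : Set C :=
  φ '' {f | ∃ x, G.Inc e x ∧ G.Inc f x}

/-- `e` and its adjacent edges use precisely three colors. -/
def IsPoor {C : Type*} (G : Graph α β) (φ : β → C) (e : β) : Prop :=
  (G.colorsAround φ e).ncard = 3

/-- `e` and its adjacent edges use precisely five colors. -/
def IsRich {C : Type*} (G : Graph α β) (φ : β → C) (e : β) : Prop :=
  (G.colorsAround φ e).ncard = 5

/-- An edge is normal if it is rich or poor. -/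
def IsNormalEdge {C : Type*} (G : Graph α β) (φ : β → C) (e : β) : Prop :=
  G.IsPoor φ e ∨ G.IsRich φ e

end Graph

/-! Take 1-factors attaining `mu3` (Petersen's theorem, `IsCubic.exists_isOneFactor`, provides a
triple at all) and let Eᵢ be the set of edges lying in exactly i of the three. The edges at a vertex
are of types 0,0,3 or 0,1,2 or 1,1,1, so E₀ ∪ E₂ is a disjoint union of cycles on which no two edges
of E₂ are consecutive. Cutting a cycle at its edges of E₀ leaves as many items as it has such edges;
an item is a vertex of type 0,0,3 or an edge of E₂. It is enough to color so that each cycle is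
charged at most one edge that is not normal per item: the total is then at most |E₀|, the number of
uncovered edges.

An edge in only one 1-factor gets the index of that factor, one of 0, 1, 2, as its color; edges of
E₃ get 3 or 4; the colors of E₀ are chosen along the cycles and determine those of E₂. Normality is
made local by prescribing, at each end of an edge, two admissible color sets for the other edges
there. For color c in E₁ these are {3,4} and {0,1,2} without c; for an edge of E₃ of color e with
target x they are {7-e,x} and {0,1,2} without x. The two sets are disjoint, so an edge with
admissible sets at both ends is poor or rich. An edge of E₂ is normal if its two neighbors in E₀
have the same color, and an edge of E₀ if the sets at its ends are equal or disjoint.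

If all edges of E₃ at a cycle have color 3, the cycle can be cut into blocks passed from color 4 to
color 4. A vertex must change the color, so vertices are paired; an odd number of them is handled by
a long run of E₂ edges or by one group of three or five vertices (`closed_flatMap_segment`). The
exceptions are triangles with three vertex items, and digons with one vertex and one edge item. A
digon needs a target different from its pendent color; a triangle needs three distinct targets or an
edge of color 4. Color 4 is therefore given to a maximal set of E₃ edges joining exceptional cycles,
no two of them sharing a cycle. Maximality makes the remaining demands on targets compatible
(`exists_targets`).

For the count, every edge of E₀ is split into two darts. The total charge is at most the number of
darts (`CoreDarts.exists_coloring`), and every edge that is not normal is charged at two darts or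
more (`IsDartColoring.exists_two_darts`). -/

/-- The pieces of a cycle of `E₀ ∪ E₂`, separated by its edges in `E₀`. -/
inductive CoreItem where
  /-- a vertex on an edge of `E₃` which has color `e` and whose end should see the colors
  `7 - e` and `x`, or else the other two of the colors `0, 1, 2` -/
  | vertex (e x : ℕ)
  /-- an edge of `E₂` with pendent edges of color `c` -/
  | edge (c : ℕ)

/-! ### Passing the items of a cycle: colors, costs, closed lists and blocks. -/

namespace CoreItem

/-- The color of an edge of `E₂` lying between edges of colors `a` and `b`, the pendent edges
having color `c`. -/
def midColor (c a b : ℕ) : ℕ :=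
  bif (min a b).blt 3 then bif (max a b).blt 3 && a != b then 4 else 3 - c - min a b
  else 7 - min a b

/-- `i` may be entered through color `a` and left through color `b`. -/
def valid : CoreItem → ℕ → ℕ → Bool
  | vertex e _, a, b => a != b && a != e && b != e && a.blt 5 && b.blt 5
  | edge c, a, b => a != c && b != c && midColor c a b != a && midColor c a b != b &&
      a.blt 5 && b.blt 5

/-- The set of the other two colors at the end where color `a` enters `i`, as a bit mask. -/
def others : CoreItem → ℕ → ℕ → ℕ
  | vertex e _, _, b => 2 ^ b + 2 ^ e
  | edge c, a, b => 2 ^ midColor c a b + 2 ^ c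

/-- The number of edges charged to `i`: ends of an edge of `E₃` or of `E₁` with unsuitable
neighbors, and edges of `E₂` which are not normal. -/
def cost : CoreItem → ℕ → ℕ → ℕ
  | vertex e x, a, b =>
      bif 2 ^ a + 2 ^ b == 2 ^ (7 - e) + 2 ^ x || 2 ^ a + 2 ^ b == 7 - 2 ^ x then 0 else 1
  | edge c, a, b =>
      (bif 2 ^ a + 2 ^ midColor c a b == 24 || 2 ^ a + 2 ^ midColor c a b == 7 - 2 ^ c
        then 0 else 1) +
      (bif 2 ^ b + 2 ^ midColor c a b == 24 || 2 ^ b + 2 ^ midColor c a b == 7 - 2 ^ c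
        then 0 else 1) +
      (bif a == b then 0 else 1)

/-- `1` if an edge whose ends see the color sets `R` and `S` is not normal; the mask `127` stands
for an unknown set. -/
def clash (R S : ℕ) : ℕ :=
  bif R == 127 then 1 else bif R == S || R &&& S == 0 then 0 else 1

/-- The items of `l` can be passed from the color `a` (with other colors `R`) to the color `a'`
(with other colors `R'`) at cost at most `n`. -/
def Path : List CoreItem → ℕ → ℕ → ℕ → ℕ → ℕ → Prop
  | [], a, R, a', R', _ => a = a' ∧ R = R'
  | i :: l, a, R, a', R', n => ∃ b k, i.valid a b = true ∧
      i.cost a b + clash R (i.others a b) + k ≤ n ∧ Path l b (i.others b a) a' R' k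

theorem Path.mono {l : List CoreItem} {a R a' R' m n : ℕ} (h : Path l a R a' R' m)
    (hmn : m ≤ n) : Path l a R a' R' n := by
  cases l with
  | nil => exact h
  | cons i l =>
    obtain ⟨b, k, hv, hc, hp⟩ := h
    exact ⟨b, k, hv, hc.trans hmn, hp⟩

theorem Path.append {l₁ l₂ : List CoreItem} {a R a' R' a'' R'' m n : ℕ}
    (h₁ : Path l₁ a R a' R' m) (h₂ : Path l₂ a' R' a'' R'' n) :
    Path (l₁ ++ l₂) a R a'' R'' (m + n) := by
  induction l₁ generalizing a R m with
  | nil =>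
    obtain ⟨rfl, rfl⟩ := h₁
    exact h₂.mono (Nat.le_add_left _ _)
  | cons i l ih =>
    obtain ⟨b, k, hv, hc, hp⟩ := h₁
    exact ⟨b, k + n, hv, by omega, ih hp⟩

theorem Path.exists_of_append {l₁ l₂ : List CoreItem} {a R a'' R'' n : ℕ}
    (h : Path (l₁ ++ l₂) a R a'' R'' n) :
    ∃ a' R' k m, Path l₁ a R a' R' k ∧ Path l₂ a' R' a'' R'' m ∧ k + m ≤ n := by
  induction l₁ generalizing a R n with
  | nil => exact ⟨a, R, 0, n, ⟨rfl, rfl⟩, h, by omega⟩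
  | cons i l ih =>
    obtain ⟨b, k, hv, hc, hp⟩ := h
    obtain ⟨a', R', k', m, h₁, h₂, hkm⟩ := ih hp
    exact ⟨a', R', i.cost a b + clash R (i.others a b) + k', m,
      ⟨b, k', hv, le_rfl, h₁⟩, h₂, by omega⟩

theorem clash_le_one (R S : ℕ) : clash R S ≤ 1 := by
  unfold clash
  cases R == 127 <;> cases (R == S || R &&& S == 0) <;> simp

/-- The unknown mask always pays 1 for the first comparison, which is the most any known mask can
pay. -/
theorem Path.of_unknown {l : List CoreItem} {a a' R' n : ℕ} (hl : l ≠ [])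
    (h : Path l a 127 a' R' n) (R : ℕ) : Path l a R a' R' n := by
  cases l with
  | nil => exact absurd rfl hl
  | cons i l =>
    obtain ⟨b, k, hv, hc, hp⟩ := h
    refine ⟨b, k, hv, ?_, hp⟩
    have h1 : clash 127 (i.others a b) = 1 := rfl
    have := clash_le_one R (i.others a b)
    omega

/-- A cyclic list of items can be colored with at most as many charges as items. -/
def Closed (l : List CoreItem) : Prop :=
  ∃ a R, Path l a R a R l.length

/-- The state reached between the two halves serves as the new starting state. -/
theorem Closed.rotate {l₁ l₂ : List CoreItem} (h : Closed (l₁ ++ l₂)) : Closed (l₂ ++ l₁) := by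
  obtain ⟨a, R, h⟩ := h
  obtain ⟨a', R', k, m, h₁, h₂, hkm⟩ := h.exists_of_append
  refine ⟨a', R', (h₂.append h₁).mono ?_⟩
  simp only [List.length_append] at hkm ⊢
  omega

/-- A list of items which can be passed from color `4` to color `4`, whatever precedes it, with at
most as many charges as items. -/
def Block (l : List CoreItem) : Prop :=
  ∃ R, Path l 4 127 4 R l.length

theorem Block.nil : Block [] := ⟨127, rfl, rfl⟩

/-- The second block has already paid for the comparison across the junction, since it starts from
the unknown mask. -/
theorem Block.append {l₁ l₂ : List CoreItem} (h₁ : Block l₁) (h₂ : Block l₂) :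
    Block (l₁ ++ l₂) := by
  rcases eq_or_ne l₂ [] with rfl | hl
  · simpa using h₁
  obtain ⟨R, h₁⟩ := h₁
  obtain ⟨R', h₂⟩ := h₂
  exact ⟨R', by simpa using h₁.append (h₂.of_unknown hl R)⟩

theorem Block.closed {l : List CoreItem} (h : Block l) : Closed l := by
  obtain ⟨R, h⟩ := h
  rcases eq_or_ne l [] with rfl | hl
  · exact ⟨4, 127, rfl, rfl⟩
  · exact ⟨4, R, h.of_unknown hl R⟩

/-- `i` is `j` or is obtained from it by specifying the target. -/
def Refines (i j : CoreItem) : Prop :=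
  i = j ∨ ∃ e x, i = vertex e x ∧ j = vertex e 9

/-- The value 9 stands for "no target": a mask involving `2 ^ 9` exceeds every mask of two colors,
and `7 - 2 ^ 9` truncates to 0. Lists that close with target 9 close with any targets. -/
theorem cost_vertex_nine {a b : ℕ} (e : ℕ) (ha : a < 5) (hb : b < 5) :
    cost (vertex e 9) a b = 1 := by
  have h2 : 2 ^ a + 2 ^ b < 512 := by interval_cases a <;> interval_cases b <;> norm_num
  have h3 : 0 < 2 ^ a + 2 ^ b := by positivity
  simp only [cost]
  generalize 2 ^ a + 2 ^ b = s at h2 h3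
  generalize 2 ^ (7 - e) = t
  have h4 : (s == t + 2 ^ 9) = false := beq_eq_false_iff_ne.2 (by omega)
  have h5 : (s == 7 - 2 ^ 9) = false := beq_eq_false_iff_ne.2 (by omega)
  rw [h4, h5]
  rfl

theorem cost_vertex_le_one (e x a b : ℕ) : cost (vertex e x) a b ≤ 1 := by
  simp only [cost]
  cases (2 ^ a + 2 ^ b == 2 ^ (7 - e) + 2 ^ x || 2 ^ a + 2 ^ b == 7 - 2 ^ x)
  · exact le_refl 1
  · exact Nat.zero_le 1

theorem Path.refine {l l' : List CoreItem} {a R a' R' n : ℕ} (hl : List.Forall₂ Refines l l')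
    (h : Path l' a R a' R' n) (ha : a < 5) : Path l a R a' R' n := by
  induction hl generalizing a R n with
  | nil => exact h
  | @cons i j l l' hij _ ih =>
    obtain ⟨b, k, hv, hc, hp⟩ := h
    have hb : b < 5 := by
      cases j <;> simp [valid] at hv <;> omega
    rcases hij with rfl | ⟨e, x, rfl, rfl⟩
    · exact ⟨b, k, hv, hc, ih hp hb⟩
    · refine ⟨b, k, hv, le_trans ?_ hc, ih hp hb⟩
      have h1 := cost_vertex_nine e ha hb
      have h2 := cost_vertex_le_one e x a b
      have h3 : others (vertex e x) a b = others (vertex e 9) a b := rfl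
      rw [h3, h1]
      omega

theorem Block.refine {l l' : List CoreItem} (hl : List.Forall₂ Refines l l') (h : Block l') :
    Block l := by
  obtain ⟨R, h⟩ := h
  exact ⟨R, by rw [hl.length_eq]; exact h.refine hl (by norm_num)⟩

theorem Closed.refine {l l' : List CoreItem} (hl : List.Forall₂ Refines l l')
    (h : Closed l') : Closed l := by
  obtain ⟨a, R, h⟩ := h
  rw [← hl.length_eq] at h
  cases hl with
  | nil => exact ⟨a, R, h⟩
  | @cons i j l l' hij hl =>
    refine ⟨a, R, Path.refine (.cons hij hl) h ?_⟩
    obtain ⟨b, k, hv, -⟩ := h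
    cases j <;> simp [valid] at hv <;> omega

/-! ### Checking explicit colorings -/

/-- The cost of leaving the items of `l` through the colors in `bs`. -/
def listCost : List CoreItem → List ℕ → ℕ → ℕ → ℕ
  | i :: l, b :: bs, a, R => (bif i.valid a b then 0 else 99) + i.cost a b +
      clash R (i.others a b) + listCost l bs b (i.others b a)
  | [], _, _, _ => 0
  | _ :: _, [], _, _ => 99

/-- The last color. -/
def listColor : List CoreItem → List ℕ → ℕ → ℕ
  | _ :: l, b :: bs, _ => listColor l bs b
  | _, _, a => a

/-- The set of other colors at the last item. -/
def listOthers : List CoreItem → List ℕ → ℕ → ℕ → ℕ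
  | i :: l, b :: bs, a, _ => listOthers l bs b (i.others b a)
  | _, _, _, R => R

/-- The penalty 99 for an invalid or missing color exceeds every budget in use, so a cost below it
certifies validity. -/
theorem path_of_listCost {l : List CoreItem} {bs : List ℕ} {a R n : ℕ}
    (h : listCost l bs a R ≤ n) (hn : n < 99) :
    Path l a R (listColor l bs a) (listOthers l bs a R) n := by
  induction l generalizing bs a R n with
  | nil => cases bs <;> exact ⟨rfl, rfl⟩
  | cons i l ih =>
    cases bs with
    | nil => simp [listCost] at h; omega
    | cons b bs =>
      simp only [listCost] at h
      have hv : i.valid a b = true := by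
        by_contra hv
        simp only [Bool.not_eq_true] at hv
        rw [hv] at h
        simp at h
        omega
      rw [hv] at h
      simp only [cond_true] at h
      exact ⟨b, listCost l bs b (i.others b a), hv, by omega, ih le_rfl (by omega)⟩

/-- Some list in `cs` shows that `l` is a block. -/
def blockCheck (l : List CoreItem) (cs : List (List ℕ)) : Bool :=
  cs.any fun bs => (listCost l bs 4 127).ble l.length && listColor l bs 4 == 4

theorem block_of_check {l : List CoreItem} {cs : List (List ℕ)} (h : blockCheck l cs = true)
    (hl : l.length < 99) : Block l := by
  simp only [blockCheck, List.any_eq_true, Bool.and_eq_true, Nat.ble_eq, beq_iff_eq] at h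
  obtain ⟨bs, -, h, h4⟩ := h
  have := path_of_listCost h hl
  rw [h4] at this
  exact ⟨_, this⟩

/-- Some list in `cs` shows that `l` is closed. -/
def closedCheck (l : List CoreItem) (cs : List (List ℕ)) : Bool :=
  cs.any fun bs => (listCost l bs (bs.getLastD 0) (listOthers l bs (bs.getLastD 0) 0)).ble l.length
    && listColor l bs (bs.getLastD 0) == bs.getLastD 0

/-- The final mask depends only on the last item. In `closedCheck` it can thus be computed from a
dummy 0 and then used as the initial mask. -/
theorem listOthers_eq {l : List CoreItem} {bs : List ℕ} {a R R' : ℕ} (hl : l ≠ [])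
    (hb : bs ≠ []) : listOthers l bs a R = listOthers l bs a R' := by
  cases l with
  | nil => exact absurd rfl hl
  | cons i l => cases bs with
    | nil => exact absurd rfl hb
    | cons b bs => rfl

theorem closed_of_check {l : List CoreItem} {cs : List (List ℕ)} (h : closedCheck l cs = true)
    (hl : l.length < 99) : Closed l := by
  rcases eq_or_ne l [] with rfl | hl0
  · exact ⟨0, 0, rfl, rfl⟩
  simp only [closedCheck, List.any_eq_true, Bool.and_eq_true, Nat.ble_eq, beq_iff_eq] at h
  obtain ⟨bs, -, h, h4⟩ := h
  rcases eq_or_ne bs [] with rfl | hb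
  · cases l with
    | nil => exact absurd rfl hl0
    | cons i l => simp only [listCost] at h; omega
  have := path_of_listCost h hl
  rw [h4, listOthers_eq (R := listOthers _ _ _ _) (R' := 0) hl0 hb] at this
  exact ⟨_, _, this⟩

end CoreItem

/-! ### Short lists settled by explicit colorings, and cyclic lists assembled from them. -/

namespace CoreItem

/-- Passing from 4 to 4 gives the E₂ edge color 3, so both pendent edges see {3,4}; the only charge
is the comparison with what precedes. -/
theorem block_edge : ∀ c < 3, blockCheck [edge c] [[4]] = true := by decide +kernel

/-- The middle color is taken to be the target of one of the vertices. That vertex is free, and the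
edge between them sees {3,4} at both ends. -/
theorem block_vertex_vertex : ∀ x₁ < 3, ∀ x₂ < 3,
    blockCheck [vertex 3 x₁, vertex 3 x₂] [[0, 4], [1, 4], [2, 4]] = true := by decide +kernel

/-- A color a < 3 other than c is carried through the E₂ edge for free. The E₀ edges of color a see
{3,4} at one end and {0,1,2} without a at the other, so targets do not matter. -/
theorem block_vertex_edge_vertex : ∀ c < 3,
    blockCheck [vertex 3 9, edge c, vertex 3 9] [[0, 0, 4], [1, 1, 4]] = true := by decide +kernel

theorem block_vertex_edge₂_vertex : ∀ c < 3, ∀ d < 3,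
    blockCheck [vertex 3 9, edge c, edge d, vertex 3 9]
      [[0, 0, 0, 4], [1, 1, 1, 4], [2, 2, 2, 4]] = true := by decide +kernel

/-- Three pendent colors may exclude every a < 3 from passing the whole run. An E₂ edge can instead
take a back to 4 at cost 2; three edges leave enough slack for this. -/
theorem block_vertex_edge₃ : ∀ c < 3, ∀ d < 3, ∀ f < 3,
    blockCheck [vertex 3 9, edge c, edge d, edge f]
      [[0, 0, 4, 4], [1, 1, 4, 4], [2, 2, 4, 4], [0, 0, 0, 4], [1, 1, 1, 4], [2, 2, 2, 4]] =
      true := by decide +kernel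

/-- Three vertices can go 4, a, b, 4 with a and b distinct and below 3. The extra charges at the
middle vertex are paid for by the free E₂ edges, and in the lists without enough of these by meeting
targets. -/
theorem block_three_one_one : ∀ c < 3, ∀ d < 3, ∀ x₁ < 3, ∀ x₂ < 3, ∀ x₃ < 3,
    blockCheck [vertex 3 x₁, edge c, vertex 3 x₂, edge d, vertex 3 x₃]
      [[0, 0, 1, 1, 4], [1, 1, 2, 2, 4], [2, 2, 0, 0, 4], [0, 0, 2, 2, 4], [1, 1, 4, 1, 4],
        [0, 0, 4, 0, 4], [2, 2, 4, 2, 4], [1, 1, 0, 0, 4], [2, 2, 1, 1, 4]] = true := by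
  decide +kernel

theorem block_three_two_zero : ∀ c < 3, ∀ d < 3, ∀ x₁ < 3, ∀ x₂ < 3, ∀ x₃ < 3,
    blockCheck [vertex 3 x₁, edge c, edge d, vertex 3 x₂, vertex 3 x₃]
      [[0, 0, 0, 1, 4], [1, 1, 1, 2, 4], [2, 2, 2, 0, 4], [0, 0, 0, 2, 4], [1, 1, 1, 0, 4],
        [2, 2, 2, 1, 4], [0, 0, 4, 0, 4], [1, 1, 4, 1, 4], [2, 2, 4, 2, 4]] = true := by
  decide +kernel

theorem block_three_two_one : ∀ c < 3, ∀ d < 3, ∀ f < 3,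
    blockCheck [vertex 3 9, edge c, edge d, vertex 3 9, edge f, vertex 3 9]
      [[0, 0, 0, 1, 1, 4], [1, 1, 1, 0, 0, 4], [2, 2, 4, 2, 2, 4], [0, 0, 0, 2, 2, 4],
        [1, 1, 1, 2, 2, 4], [2, 2, 2, 0, 0, 4]] = true := by
  decide +kernel

theorem block_three_two_two : ∀ c < 3, ∀ d < 3, ∀ f < 3, ∀ g < 3,
    blockCheck [vertex 3 9, edge c, edge d, vertex 3 9, edge f, edge g, vertex 3 9]
      [[0, 0, 0, 1, 1, 1, 4], [1, 1, 1, 0, 0, 0, 4], [2, 2, 4, 2, 2, 2, 4],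
        [0, 0, 0, 2, 2, 2, 4], [1, 1, 4, 1, 1, 1, 4], [2, 2, 2, 0, 0, 0, 4],
        [0, 0, 4, 0, 0, 0, 4], [1, 1, 1, 2, 2, 2, 4], [2, 2, 2, 1, 1, 1, 4]] = true := by
  decide +kernel

/-- With few or no E₂ edges, five vertices leave enough choices of intermediate colors to meet
sufficiently many targets. -/
theorem block_five : ∀ x₁ < 3, ∀ x₂ < 3, ∀ x₃ < 3, ∀ x₄ < 3, ∀ x₅ < 3,
    blockCheck [vertex 3 x₁, vertex 3 x₂, vertex 3 x₃, vertex 3 x₄, vertex 3 x₅]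
      [[0, 1, 0, 1, 4], [1, 2, 1, 2, 4], [2, 0, 2, 0, 4], [0, 1, 4, 1, 4], [0, 2, 4, 2, 4],
        [1, 0, 1, 0, 4], [2, 1, 2, 1, 4], [0, 4, 0, 1, 4], [2, 4, 2, 0, 4], [1, 4, 1, 2, 4],
        [0, 1, 4, 0, 4], [0, 2, 4, 0, 4], [1, 2, 4, 1, 4], [2, 1, 4, 2, 4], [1, 0, 4, 1, 4],
        [1, 0, 4, 2, 4]] = true := by
  decide +kernel

set_option synthInstance.maxSize 1000 in
theorem block_five_first : ∀ c < 3, ∀ x₁ < 3, ∀ x₂ < 3, ∀ x₃ < 3, ∀ x₄ < 3, ∀ x₅ < 3,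
    blockCheck [vertex 3 x₁, edge c, vertex 3 x₂, vertex 3 x₃, vertex 3 x₄, vertex 3 x₅]
      [[0, 0, 1, 0, 1, 4], [1, 1, 2, 1, 2, 4], [2, 2, 0, 2, 0, 4], [0, 0, 2, 0, 2, 4],
        [2, 2, 4, 2, 1, 4], [1, 1, 0, 1, 0, 4], [2, 2, 1, 2, 1, 4]] = true := by
  decide +kernel

set_option synthInstance.maxSize 1000 in
theorem block_five_first_third : ∀ c < 3, ∀ d < 3,
    ∀ x₁ < 3, ∀ x₂ < 3, ∀ x₃ < 3, ∀ x₄ < 3, ∀ x₅ < 3,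
    blockCheck [vertex 3 x₁, edge c, vertex 3 x₂, vertex 3 x₃, edge d, vertex 3 x₄, vertex 3 x₅]
      [[0, 0, 4, 0, 0, 1, 4], [1, 1, 4, 1, 1, 2, 4], [2, 2, 4, 2, 2, 0, 4],
        [0, 0, 1, 4, 4, 0, 4], [1, 1, 2, 4, 4, 1, 4], [2, 2, 0, 4, 4, 2, 4],
        [0, 0, 2, 4, 4, 2, 4], [1, 1, 0, 4, 4, 0, 4], [2, 2, 1, 4, 4, 1, 4],
        [0, 0, 1, 4, 4, 1, 4], [0, 0, 4, 1, 1, 2, 4], [1, 1, 0, 1, 1, 0, 4]] = true := by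
  decide +kernel

set_option synthInstance.maxSize 1000 in
theorem block_five_first_fourth : ∀ c < 3, ∀ d < 3,
    ∀ x₁ < 3, ∀ x₂ < 3, ∀ x₃ < 3, ∀ x₄ < 3, ∀ x₅ < 3,
    blockCheck [vertex 3 x₁, edge c, vertex 3 x₂, vertex 3 x₃, vertex 3 x₄, edge d, vertex 3 x₅]
      [[0, 0, 1, 0, 1, 1, 4], [1, 1, 2, 1, 2, 2, 4], [2, 2, 0, 2, 0, 0, 4],
        [0, 0, 2, 0, 2, 2, 4], [1, 1, 0, 4, 0, 0, 4], [2, 2, 1, 4, 1, 1, 4],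
        [0, 0, 2, 4, 2, 2, 4], [0, 0, 1, 4, 1, 1, 4], [0, 0, 2, 1, 2, 2, 4],
        [1, 1, 2, 4, 2, 2, 4]] = true := by
  decide +kernel

theorem closed_vertex_edge₂ : ∀ c < 3, ∀ d < 3,
    closedCheck [vertex 3 9, edge c, edge d] [[0, 0, 4], [1, 1, 4], [2, 2, 4]] = true := by
  decide +kernel

theorem closed_three_one : ∀ c < 3, ∀ x₁ < 3, ∀ x₂ < 3, ∀ x₃ < 3,
    closedCheck [vertex 3 x₁, edge c, vertex 3 x₂, vertex 3 x₃]
      [[0, 4, 0, 4], [1, 4, 1, 4], [2, 4, 2, 4], [0, 1, 0, 1], [0, 2, 0, 2], [1, 2, 1, 2]] =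
      true := by decide +kernel

/-- With colors 0, 1, 2 all three E₀ edges clash, because color 3 is seen at every vertex. All
vertices must then be free, which happens when each one misses its own target; this needs distinct
targets. -/
theorem closed_triangle : ∀ x₁ < 3, ∀ x₂ < 3, ∀ x₃ < 3, x₁ ≠ x₂ ∧ x₁ ≠ x₃ ∧ x₂ ≠ x₃ →
    closedCheck [vertex 3 x₁, vertex 3 x₂, vertex 3 x₃]
      [[0, 1, 2], [0, 1, 4], [0, 2, 1], [0, 2, 4], [0, 4, 1], [0, 4, 2]] = true := by
  decide +kernel

/-- In colors 0, 1, 2, an E₀ edge whose ends carry E₃ edges of colors 3 and 4 is rich. Only one edge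
clashes, and a single vertex missing its target brings the total down to three. -/
theorem closed_triangle_one : ∀ x₁ < 3, ∀ x₂ < 3, ∀ x₃ < 3,
    closedCheck [vertex 4 x₁, vertex 3 x₂, vertex 3 x₃] [[0, 1, 2], [1, 2, 0], [0, 2, 1]] =
      true := by decide +kernel

/-- The two items of color 4 are the ends of a single E₃ edge, hence have the same target. -/
theorem closed_triangle_two : ∀ x₁ < 3, ∀ x₂ < 3,
    closedCheck [vertex 4 x₁, vertex 4 x₁, vertex 3 x₂] [[0, 1, 2], [1, 0, 2]] = true := by
  decide +kernel

/-- The E₂ edge between different colors already costs 2, so nothing else may be charged. The E₀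
edges get colors x and `7 - e`, which is possible because x differs from the pendent color. -/
theorem closed_vertex_edge : ∀ x < 3, ∀ c < 3, x ≠ c → ∀ e < 5, 3 ≤ e →
    closedCheck [vertex e x, edge c] [[0, 3], [0, 4], [1, 3], [1, 4], [2, 3], [2, 4]] = true := by
  decide +kernel

/-! ### Cyclic lists -/

/-- A vertex of color `3` with target `s.1`, followed by edges with pendent colors `s.2`. -/
def segment (s : ℕ × List ℕ) : List CoreItem :=
  vertex 3 s.1 :: s.2.map edge

/-- All labels are less than `3`. -/
def SegmentOK (s : ℕ × List ℕ) : Prop :=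
  s.1 < 3 ∧ ∀ c ∈ s.2, c < 3

theorem refines_vertex (e x : ℕ) : Refines (vertex e x) (vertex e 9) := .inr ⟨e, x, rfl, rfl⟩

theorem refines_refl (i : CoreItem) : Refines i i := .inl rfl

theorem block_edges {cs : List ℕ} (h : ∀ c ∈ cs, c < 3) : Block (cs.map edge) := by
  induction cs with
  | nil => exact Block.nil
  | cons c cs ih =>
    exact (block_of_check (block_edge c (h c (by simp))) (by simp)).append
      (ih fun d hd ↦ h d (by simp [hd]))

theorem block_long {s : ℕ × List ℕ} (hs : SegmentOK s) (hl : 3 ≤ s.2.length) :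
    Block (segment s) := by
  obtain ⟨x, cs⟩ := s
  obtain ⟨hx, hc⟩ := hs
  match cs, hl with
  | c :: d :: f :: cs, _ =>
    have h : Block [vertex 3 x, edge c, edge d, edge f] := by
      refine Block.refine (l' := [vertex 3 9, edge c, edge d, edge f]) ?_
        (block_of_check (block_vertex_edge₃ c ?_ d ?_ f ?_) (by simp))
      · simp [refines_vertex, refines_refl]
      all_goals exact hc _ (by simp)
    exact h.append (block_edges fun g hg ↦ hc g (by simp [hg]))

theorem block_pair {s : ℕ × List ℕ} {x : ℕ} (hs : SegmentOK s) (hl : s.2.length ≤ 2)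
    (hx : x < 3) : Block (segment s ++ [vertex 3 x]) := by
  obtain ⟨y, cs⟩ := s
  obtain ⟨hy, hc⟩ := hs
  match cs, hl with
  | [], _ => exact block_of_check (block_vertex_vertex y hy x hx) (by simp [segment])
  | [c], _ =>
    refine Block.refine (l' := [vertex 3 9, edge c, vertex 3 9]) ?_
      (block_of_check (block_vertex_edge_vertex c (hc c (by simp))) (by simp))
    simp [segment, refines_vertex, refines_refl]
  | [c, d], _ =>
    refine Block.refine (l' := [vertex 3 9, edge c, edge d, vertex 3 9]) ?_
      (block_of_check (block_vertex_edge₂_vertex c (hc c (by simp)) d (hc d (by simp))) (by simp))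
    simp [segment, refines_vertex, refines_refl]

theorem block_even : ∀ {S : List (ℕ × List ℕ)}, (∀ s ∈ S, SegmentOK s) →
    (∀ s ∈ S, s.2.length ≤ 2) → Even S.length → Block (S.flatMap segment)
  | [], _, _, _ => Block.nil
  | [_], _, _, h => by simp at h
  | s :: t :: S, hok, hl, he => by
    have h₁ := block_pair (hok s (by simp)) (hl s (by simp)) (hok t (by simp)).1
    have h₂ := block_edges (hok t (by simp)).2
    have h₃ := block_even (S := S) (fun s hs ↦ hok s (by simp [hs]))
      (fun s hs ↦ hl s (by simp [hs])) (by simpa [Nat.even_add_one] using he)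
    simpa [segment] using (h₁.append h₂).append h₃

/-- Working from the left, short segments are paired and long ones stand alone. A long last segment
absorbs the parity: either it is left over and is a block itself, or its vertex is used by a pair
and its edges are single blocks. -/
theorem block_long_last {s : ℕ × List ℕ} (hs : SegmentOK s) (hl : 3 ≤ s.2.length) :
    ∀ {S : List (ℕ × List ℕ)}, (∀ s ∈ S, SegmentOK s) → Block (S.flatMap segment ++ segment s)
  | [], _ => block_long hs hl
  | [t], hok => by
    by_cases ht : 3 ≤ t.2.length
    · simpa using (block_long (hok t (by simp)) ht).append (block_long hs hl)
    · have h₁ := block_pair (hok t (by simp)) (by omega) hs.1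
      simpa [segment] using h₁.append (block_edges hs.2)
  | t :: u :: S, hok => by
    by_cases ht : 3 ≤ t.2.length
    · have := block_long_last hs hl (S := u :: S) (fun s hs ↦ hok s (by simp at hs ⊢; tauto))
      simpa using (block_long (hok t (by simp)) ht).append this
    · have h₁ := block_pair (hok t (by simp)) (by omega) (hok u (by simp)).1
      have h₂ := block_edges (hok u (by simp)).2
      have h₃ := block_long_last hs hl (S := S) (fun s hs ↦ hok s (by simp [hs]))
      simpa [segment] using (h₁.append h₂).append h₃

/-- An odd block, up to the first item of the third segment. -/
theorem block_triple {s t : ℕ × List ℕ} {x : ℕ} (hs : SegmentOK s) (ht : SegmentOK t)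
    (hx : x < 3) (h : s.2.length = 2 ∧ t.2.length ≤ 2 ∨ s.2.length = 1 ∧ t.2.length = 1) :
    Block (segment s ++ segment t ++ [vertex 3 x]) := by
  obtain ⟨y, cs⟩ := s
  obtain ⟨z, ds⟩ := t
  obtain ⟨hy, hc⟩ := hs
  obtain ⟨hz, hd⟩ := ht
  simp only at hy hz hc hd h
  match cs, ds, h with
  | [c], [d], _ =>
    exact block_of_check (block_three_one_one c (hc c (by simp)) d (hd d (by simp)) y hy z hz x hx)
      (by simp [segment])
  | [c, d], [], _ =>
    exact block_of_check (block_three_two_zero c (hc c (by simp)) d (hc d (by simp)) y hy z hz x hx)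
      (by simp [segment])
  | [c, d], [f], _ =>
    refine Block.refine (l' := [vertex 3 9, edge c, edge d, vertex 3 9, edge f, vertex 3 9]) ?_
      (block_of_check (block_three_two_one c (hc c (by simp)) d (hc d (by simp)) f
        (hd f (by simp))) (by simp))
    simp [segment, refines_vertex, refines_refl]
  | [c, d], [f, g], _ =>
    refine Block.refine
      (l' := [vertex 3 9, edge c, edge d, vertex 3 9, edge f, edge g, vertex 3 9]) ?_
      (block_of_check (block_three_two_two c (hc c (by simp)) d (hc d (by simp)) f
        (hd f (by simp)) g (hd g (by simp))) (by simp))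
    simp [segment, refines_vertex, refines_refl]

theorem block_triple_append {s t u : ℕ × List ℕ} {S : List (ℕ × List ℕ)}
    (hok : ∀ r ∈ s :: t :: u :: S, SegmentOK r) (hl : ∀ r ∈ S, r.2.length ≤ 2)
    (he : Even S.length)
    (h : s.2.length = 2 ∧ t.2.length ≤ 2 ∨ s.2.length = 1 ∧ t.2.length = 1) :
    Block ((s :: t :: u :: S).flatMap segment) := by
  have h₁ := block_triple (hok s (by simp)) (hok t (by simp)) (hok u (by simp)).1 h
  have h₂ := block_edges (hok u (by simp)).2
  have h₃ := block_even (S := S) (fun r hr ↦ hok r (by simp [hr])) hl he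
  simpa [segment] using (h₁.append h₂).append h₃

/-- The edges following the last vertex of the group are blocks by themselves, and an even number of
short segments remains to be paired. -/
theorem block_quintuple_append {s t u v w : ℕ × List ℕ} {S : List (ℕ × List ℕ)}
    (hok : ∀ r ∈ s :: t :: u :: v :: w :: S, SegmentOK r) (hl : ∀ r ∈ S, r.2.length ≤ 2)
    (he : Even S.length) (ht : t.2.length = 0)
    (h : s.2.length = 1 ∧ (u.2.length ≤ 1 ∧ v.2.length = 0 ∨ u.2.length = 0 ∧ v.2.length = 1) ∨
      s.2.length = 0 ∧ u.2.length = 0 ∧ v.2.length = 0) :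
    Block ((s :: t :: u :: v :: w :: S).flatMap segment) := by
  have h₁ : Block (segment s ++ segment t ++ segment u ++ segment v ++ [vertex 3 w.1]) := by
    have hw := (hok w (by simp)).1
    obtain ⟨x₁, cs₁⟩ := s
    obtain ⟨x₂, cs₂⟩ := t
    obtain ⟨x₃, cs₃⟩ := u
    obtain ⟨x₄, cs₄⟩ := v
    obtain ⟨hx₁, hc₁⟩ := hok (x₁, cs₁) (by simp)
    obtain ⟨hx₂, -⟩ := hok (x₂, cs₂) (by simp)
    obtain ⟨hx₃, hc₃⟩ := hok (x₃, cs₃) (by simp)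
    obtain ⟨hx₄, hc₄⟩ := hok (x₄, cs₄) (by simp)
    simp only at *
    match cs₁, cs₂, cs₃, cs₄, h, ht with
    | [], [], [], [], _, _ =>
      exact block_of_check (block_five x₁ hx₁ x₂ hx₂ x₃ hx₃ x₄ hx₄ w.1 hw) (by simp [segment])
    | [c], [], [], [], _, _ =>
      exact block_of_check (block_five_first c (hc₁ c (by simp)) x₁ hx₁ x₂ hx₂ x₃ hx₃ x₄ hx₄
        w.1 hw) (by simp [segment])
    | [c], [], [d], [], _, _ =>
      exact block_of_check (block_five_first_third c (hc₁ c (by simp)) d (hc₃ d (by simp))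
        x₁ hx₁ x₂ hx₂ x₃ hx₃ x₄ hx₄ w.1 hw) (by simp [segment])
    | [c], [], [], [d], _, _ =>
      exact block_of_check (block_five_first_fourth c (hc₁ c (by simp)) d (hc₄ d (by simp))
        x₁ hx₁ x₂ hx₂ x₃ hx₃ x₄ hx₄ w.1 hw) (by simp [segment])
  have h₂ := block_edges (hok w (by simp)).2
  have h₃ := block_even (S := S) (fun r hr ↦ hok r (by simp [hr])) hl he
  simpa [segment] using (h₁.append h₂).append h₃

theorem Closed.flatMap_rotate {S T : List (ℕ × List ℕ)} (h : Closed ((S ++ T).flatMap segment)) :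
    Closed ((T ++ S).flatMap segment) := by
  rw [List.flatMap_append] at h ⊢
  exact h.rotate

theorem closed_odd_one {s : ℕ × List ℕ} {S : List (ℕ × List ℕ)}
    (hok : ∀ r ∈ s :: S, SegmentOK r) (hl : ∀ r ∈ s :: S, r.2.length ≤ 1)
    (he : Even S.length) (hS : S ≠ []) (hs : s.2.length = 1) :
    Closed ((s :: S).flatMap segment) := by
  match S, hS, he with
  | [_], _, he => exact absurd he (by simp)
  | t :: u :: S, _, he =>
    have he' : Even S.length := by simpa [Nat.even_add_one] using he
    have ht := hl t (by simp)
    have hu := hl u (by simp)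
    have hle : ∀ r ∈ S, r.2.length ≤ 2 := fun r hr ↦ (hl r (by simp [hr])).trans (by norm_num)
    by_cases ht1 : t.2.length = 1
    · exact (block_triple_append hok hle he' (.inr ⟨hs, ht1⟩)).closed
    match S, he' with
    | [_], he' => exact absurd he' (by simp)
    | [], _ =>
      -- Cyclically `u` precedes `s`, so the two form the start of a triple.
      by_cases hu1 : u.2.length = 1
      · refine Closed.flatMap_rotate (S := [u]) (T := [s, t]) (Block.closed ?_)
        exact block_triple_append (S := []) (fun r hr ↦ hok r (by simp at hr ⊢; tauto))
          (by simp) (by simp) (.inr ⟨hu1, hs⟩)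
      · obtain ⟨x₁, cs₁⟩ := s
        obtain ⟨x₂, cs₂⟩ := t
        obtain ⟨x₃, cs₃⟩ := u
        obtain ⟨hx₁, hc₁⟩ := hok (x₁, cs₁) (by simp)
        obtain ⟨hx₂, -⟩ := hok (x₂, cs₂) (by simp)
        obtain ⟨hx₃, -⟩ := hok (x₃, cs₃) (by simp)
        simp only at *
        obtain rfl : cs₂ = [] := List.length_eq_zero_iff.1 (by omega)
        obtain rfl : cs₃ = [] := List.length_eq_zero_iff.1 (by omega)
        obtain ⟨c, rfl⟩ := List.length_eq_one_iff.1 hs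
        exact closed_of_check (closed_three_one c (hc₁ c (by simp)) x₁ hx₁ x₂ hx₂ x₃ hx₃)
          (by simp [segment])
    | v :: w :: S, he' =>
      have hv := hl v (by simp)
      -- This is the one shape not covered by the quintuple, but `u` and `v` then start a triple
      -- after rotation.
      by_cases huv : u.2.length = 1 ∧ v.2.length = 1
      · refine Closed.flatMap_rotate (S := u :: v :: w :: S) (T := [s, t]) (Block.closed ?_)
        refine block_triple_append (S := S ++ [s, t])
          (fun r hr ↦ hok r (by simp at hr ⊢; tauto))
          (fun r hr ↦ (hl r (by simp at hr ⊢; tauto)).trans (by norm_num)) ?_ (.inr huv)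
        simpa [Nat.even_add_one] using he'
      · refine (block_quintuple_append hok (fun r hr ↦ hle r (by simp [hr]))
          (by simpa [Nat.even_add_one] using he') (by omega) (.inl ⟨hs, ?_⟩)).closed
        omega

/-- Every cyclic list of segments is closed, apart from a few very short ones. -/
theorem closed_flatMap_segment {S : List (ℕ × List ℕ)} (hok : ∀ s ∈ S, SegmentOK s)
    (h₁ : ∀ x, S ≠ [(x, [])]) (h₂ : ∀ x c, S ≠ [(x, [c])])
    (h₃ : ∀ x y z, S ≠ [(x, []), (y, []), (z, [])]) :
    Closed (S.flatMap segment) := by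
  by_cases hlong : ∃ s ∈ S, 3 ≤ s.2.length
  · obtain ⟨s, hs, hl⟩ := hlong
    obtain ⟨A, B, rfl⟩ := List.append_of_mem hs
    have := block_long_last (hok s (by simp)) hl (S := B ++ A)
      (fun r hr ↦ hok r (by simp at hr ⊢; tauto))
    refine Closed.flatMap_rotate (S := s :: B) (T := A) ?_
    refine Closed.flatMap_rotate (S := B ++ A) (T := [s]) (Block.closed ?_)
    simpa using this
  push Not at hlong
  replace hlong : ∀ s ∈ S, s.2.length ≤ 2 := fun s hs ↦ by have := hlong s hs; omega
  rcases Nat.even_or_odd S.length with he | ho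
  · exact (block_even hok hlong he).closed
  by_cases htwo : ∃ s ∈ S, s.2.length = 2
  · obtain ⟨s, hs, hl⟩ := htwo
    obtain ⟨A, B, rfl⟩ := List.append_of_mem hs
    refine Closed.flatMap_rotate (S := s :: B) (T := A) ?_
    have he : Even (B ++ A).length := by
      simp only [List.length_append, List.length_cons] at ho ⊢
      rw [← add_assoc, Nat.odd_add_one, Nat.not_odd_iff_even, add_comm] at ho
      exact ho
    have hok' : ∀ r ∈ s :: (B ++ A), SegmentOK r := fun r hr ↦ hok r (by simp at hr ⊢; tauto)
    have hl' : ∀ r ∈ s :: (B ++ A), r.2.length ≤ 2 := fun r hr ↦ hlong r (by simp at hr ⊢; tauto)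
    rw [List.cons_append]
    generalize B ++ A = C at *
    match C, he with
    | [_], he => exact absurd he (by simp)
    | [], _ =>
      obtain ⟨x, cs⟩ := s
      obtain ⟨-, hc⟩ := hok' (x, cs) (by simp)
      simp only at hc hl
      match cs, hl with
      | [c, d], _ =>
        refine Closed.refine (l' := [vertex 3 9, edge c, edge d]) ?_
          (closed_of_check (closed_vertex_edge₂ c (hc c (by simp)) d (hc d (by simp))) (by simp))
        simp [segment, refines_vertex, refines_refl]
    | t :: u :: C, he =>
      exact (block_triple_append hok' (fun r hr ↦ hl' r (by simp [hr]))
        (by simpa [Nat.even_add_one] using he) (.inl ⟨hl, hl' t (by simp)⟩)).closed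
  have hone : ∀ s ∈ S, s.2.length ≤ 1 := fun s hs ↦ by
    have h1 := hlong s hs
    have h2 : s.2.length ≠ 2 := fun h ↦ htwo ⟨s, hs, h⟩
    omega
  by_cases hex : ∃ s ∈ S, s.2.length = 1
  · obtain ⟨s, hs, hl⟩ := hex
    obtain ⟨A, B, rfl⟩ := List.append_of_mem hs
    refine Closed.flatMap_rotate (S := s :: B) (T := A) ?_
    refine closed_odd_one (fun r hr ↦ hok r (by simp at hr ⊢; tauto))
      (fun r hr ↦ hone r (by simp at hr ⊢; tauto)) ?_ ?_ hl
    · change Even (B ++ A).length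
      simp only [List.length_append, List.length_cons] at ho ⊢
      rw [← add_assoc, Nat.odd_add_one, Nat.not_odd_iff_even, add_comm] at ho
      exact ho
    · intro hnil
      obtain ⟨rfl, rfl⟩ := List.append_eq_nil_iff.1 hnil
      obtain ⟨x, cs⟩ := s
      obtain ⟨c, rfl⟩ := List.length_eq_one_iff.1 hl
      exact h₂ x c rfl
  · have hzero : ∀ s ∈ S, s.2 = [] := fun s hs ↦ by
      have h1 := hone s hs
      have h2 : s.2.length ≠ 1 := fun h ↦ hex ⟨s, hs, h⟩
      exact List.length_eq_zero_iff.1 (by omega)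
    match S, ho with
    | [], ho => exact absurd ho (by simp)
    | [_, _], ho | [_, _, _, _], ho =>
      obtain ⟨k, hk⟩ := ho
      simp only [List.length_cons, List.length_nil] at hk
      omega
    | [s], _ =>
      exact absurd (by rw [← hzero s (by simp)]) (h₁ s.1)
    | [s, t, u], _ =>
      exact absurd (by rw [← hzero s (by simp), Prod.mk.eta, hzero s (by simp),
        ← hzero t (by simp), Prod.mk.eta, hzero t (by simp), ← hzero u (by simp)]) (h₃ s.1 t.1 u.1)
    | s :: t :: u :: v :: w :: S, ho =>
      refine (block_quintuple_append hok (fun r hr ↦ hlong r (by simp [hr])) ?_ ?_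
        (.inr ⟨?_, ?_, ?_⟩)).closed
      · simp only [List.length_cons, Nat.odd_add_one, Nat.not_odd_iff_even] at ho
        simpa [Nat.even_add_one] using ho
      all_goals
        rw [List.length_eq_zero_iff]
        exact hzero _ (by simp)

end CoreItem

/-! ### Cycles as orbits of two involutions, and colorings glued orbit by orbit. -/

namespace CoreItem

open Finset Function

theorem midColor_comm (c a b : ℕ) : midColor c a b = midColor c b a := by
  unfold midColor
  rw [min_comm, max_comm, bne_comm]

theorem valid_comm (i : CoreItem) (a b : ℕ) (h : i.valid a b = true) : i.valid b a = true := by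
  cases i with
  | vertex e x => simp [valid] at h ⊢; tauto
  | edge c => simp only [valid, midColor_comm c b a] at h ⊢; simp at h ⊢; tauto

theorem cost_comm (i : CoreItem) (a b : ℕ) : i.cost a b = i.cost b a := by
  cases i with
  | vertex e x => simp only [cost, add_comm (2 ^ a)]
  | edge c =>
    simp only [cost, midColor_comm c b a, BEq.comm (a := a)]
    omega

/-- Only the first argument is tested for the sentinel 127, so symmetry needs both masks to be
genuine. -/
theorem clash_comm {R S : ℕ} (hR : R ≠ 127) (hS : S ≠ 127) : clash R S = clash S R := by
  unfold clash
  rw [beq_eq_false_iff_ne.2 hR, beq_eq_false_iff_ne.2 hS, BEq.comm (a := R), Nat.and_comm]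

theorem others_ne {i : CoreItem} {a b : ℕ} (h : i.valid a b = true) (he : ∀ e x, i = vertex e x → e < 5)
    (hc : ∀ c, i = edge c → c < 5) :
    i.others a b ≠ 127 := by
  have key : ∀ a < 8, ∀ b < 5, 2 ^ a + 2 ^ b ≠ 127 := by decide
  cases i with
  | vertex e x =>
    simp [valid] at h
    exact key b (by omega) e (he e x rfl)
  | edge c =>
    refine key _ ?_ c (hc c rfl)
    unfold midColor
    cases (min a b).blt 3 <;> cases ((max a b).blt 3 && a != b) <;> simp <;> omega

theorem Path.exists_colors {it : ℕ → CoreItem} {s m a R a' R' n : ℕ}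
    (h : Path ((List.range' s m).map it) a R a' R' n) :
    ∃ f r : ℕ → ℕ, f s = a ∧ r s = R ∧ f (s + m) = a' ∧ r (s + m) = R' ∧
      (∀ i, s ≤ i → i < s + m → (it i).valid (f i) (f (i + 1)) = true ∧
        r (i + 1) = (it i).others (f (i + 1)) (f i)) ∧
      ∑ i ∈ Ico s (s + m),
        ((it i).cost (f i) (f (i + 1)) + clash (r i) ((it i).others (f i) (f (i + 1)))) ≤ n := by
  induction m generalizing s a R n with
  | zero =>
    obtain ⟨rfl, rfl⟩ := h
    exact ⟨fun _ ↦ a, fun _ ↦ R, rfl, rfl, rfl, rfl, fun i h1 h2 ↦ by omega, by simp⟩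
  | succ m ih =>
    obtain ⟨b, k, hv, hc, hp⟩ := h
    obtain ⟨f, r, hf, hr, hf', hr', h₁, h₂⟩ := ih hp
    have hne : ∀ i, s + 1 ≤ i → i ≠ s := fun i hi ↦ by omega
    refine ⟨update f s a, update r s R, by simp, by simp, ?_, ?_, ?_, ?_⟩
    · rw [update_of_ne (by omega), ← hf']
      congr 1
      omega
    · rw [update_of_ne (by omega), ← hr']
      congr 1
      omega
    · intro i hi hi'
      rcases hi.eq_or_lt with rfl | hlt
      · simp [hf, hr, hv]
      · rw [update_of_ne (hne _ hlt), update_of_ne (hne _ (by omega)),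
          update_of_ne (hne _ (by omega))]
        exact h₁ i hlt (by omega)
    · rw [Finset.sum_eq_sum_Ico_succ_bot (by omega)]
      have : ∑ i ∈ Ico (s + 1) (s + (m + 1)), ((it i).cost (update f s a i) (update f s a (i + 1)) +
          clash (update r s R i) ((it i).others (update f s a i) (update f s a (i + 1)))) ≤ k := by
        refine le_trans (le_of_eq ?_) h₂
        rw [show s + 1 + m = s + (m + 1) by omega]
        refine Finset.sum_congr rfl fun i hi ↦ ?_
        rw [Finset.mem_Ico] at hi
        rw [update_of_ne (hne _ hi.1), update_of_ne (hne _ (by omega)),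
          update_of_ne (hne _ hi.1)]
      simp only [update_self, update_of_ne (hne (s + 1) le_rfl), hf]
      omega

/-- The number of edges charged at a dart `d`: those of its item, and the edge of `d` if its ends
see clashing colors. -/
def charge {D : Type*} (σ τ : D → D) (it : D → CoreItem) (φ : D → ℕ) (d : D) : ℕ :=
  (it d).cost (φ d) (φ (σ d)) +
    clash ((it (τ d)).others (φ (τ d)) (φ (σ (τ d)))) ((it d).others (φ d) (φ (σ d)))

section Orbit

variable {D : Type*} {σ τ : D → D}

/-- The involution σ conjugates τσ to its inverse. If a forward dart were also a reversed one, the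
dart halfway between them would be fixed by σ (even distance), or its image under σ would be fixed
by τ (odd distance). -/
theorem iterate_ne_apply_iterate (hσ : Involutive σ) (hτ : Involutive τ) (hσ0 : ∀ d, σ d ≠ d)
    (hτ0 : ∀ d, τ d ≠ d) (d : D) (i j : ℕ) : (τ ∘ σ)^[i] d ≠ σ ((τ ∘ σ)^[j] d) := by
  have hinj : Injective (τ ∘ σ) := hτ.injective.comp hσ.injective
  have key : ∀ k y, (τ ∘ σ)^[k] (σ ((τ ∘ σ)^[k] y)) = σ y := by
    intro k
    induction k with
    | zero => intro y; rfl
    | succ k ih =>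
      intro y
      rw [iterate_succ_apply, iterate_succ_apply']
      simp only [comp_apply, hσ _, hτ _]
      exact ih y
  intro h
  have h2 : (τ ∘ σ)^[j + i] d = σ d := by
    rw [iterate_add_apply, h, key]
  obtain ⟨k, hk | hk⟩ := Nat.even_or_odd' (j + i)
  · rw [hk, two_mul, iterate_add_apply, ← key k d] at h2
    exact hσ0 _ (hinj.iterate k h2).symm
  · rw [hk, two_mul, add_assoc, iterate_add_apply, ← key k d] at h2
    have h3 := hinj.iterate k h2
    rw [add_comm, iterate_add_apply] at h3
    rw [iterate_one, comp_apply] at h3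
    exact hτ0 _ h3

/-- The items met on the way around the orbit of a dart. -/
noncomputable def cycleItems (σ τ : D → D) (it : D → CoreItem) (d : D) : List CoreItem :=
  (List.range (minimalPeriod (τ ∘ σ) d)).map fun i ↦ it ((τ ∘ σ)^[i] d)

/-- All darts on the cycle of `d`. -/
noncomputable def orbitDarts [DecidableEq D] (σ τ : D → D) (d : D) : Finset D :=
  (range (minimalPeriod (τ ∘ σ) d)).image (fun i ↦ (τ ∘ σ)^[i] d) ∪
    (range (minimalPeriod (τ ∘ σ) d)).image (fun i ↦ σ ((τ ∘ σ)^[i] d))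

/-- Going around the cycle in one direction meets each of the n items once, at total cost at most n.
The opposite direction costs the same, and there are 2n darts. -/
theorem exists_orbit_coloring [DecidableEq D] (hσ : Involutive σ) (hτ : Involutive τ)
    (hσ0 : ∀ d, σ d ≠ d) (hτ0 : ∀ d, τ d ≠ d) {it : D → CoreItem} (hit : ∀ d, it (σ d) = it d)
    (he : ∀ d e x, it d = vertex e x → e < 5) (hc : ∀ d c, it d = edge c → c < 5)
    {d : D} (hd : 0 < minimalPeriod (τ ∘ σ) d) (hcl : Closed (cycleItems σ τ it d)) :
    ∃ φ : D → ℕ, (∀ y ∈ orbitDarts σ τ d,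
      φ (τ y) = φ y ∧ (it y).valid (φ y) (φ (σ y)) = true) ∧
      ∑ y ∈ orbitDarts σ τ d, charge σ τ it φ y ≤ #(orbitDarts σ τ d) := by
  classical
  set n := minimalPeriod (τ ∘ σ) d with hn
  set p : ℕ → D := fun i ↦ (τ ∘ σ)^[i] d with hp
  have hpn : p n = p 0 := iterate_minimalPeriod
  have hps : ∀ i, p (i + 1) = τ (σ (p i)) := fun i ↦ iterate_succ_apply' _ _ _
  have hpinj : ∀ i < n, ∀ j < n, p i = p j → i = j := fun i hi j hj h ↦
    iterate_injOn_Iio_minimalPeriod (f := τ ∘ σ) (x := d) hi hj h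
  have hpσ : ∀ i j, p i ≠ σ (p j) := fun i j ↦ iterate_ne_apply_iterate hσ hτ hσ0 hτ0 d i j
  obtain ⟨a, R, hpath⟩ := hcl
  rw [cycleItems, List.length_map, List.length_range, ← hn, List.range_eq_range'] at hpath
  obtain ⟨f, r, hf0, hr0, hfn, hrn, hval, hsum⟩ := hpath.exists_colors
  rw [zero_add] at hfn hrn
  simp only [zero_add, zero_le, true_implies] at hval
  let φ : D → ℕ := fun y ↦ if h : ∃ i < n, p i = y then f h.choose
    else if h : ∃ i < n, σ (p i) = y then f (h.choose + 1) else 0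
  have hφ₁ : ∀ i ≤ n, φ (p i) = f i := by
    have : ∀ i < n, φ (p i) = f i := by
      intro i hi
      have h : ∃ j < n, p j = p i := ⟨i, hi, rfl⟩
      have h2 := h.choose_spec
      simp only [φ]
      rw [dif_pos h, hpinj _ h2.1 _ hi h2.2]
    intro i hi
    rcases hi.eq_or_lt with rfl | hlt
    · rw [hpn, this 0 hd, hf0, hfn]
    · exact this i hlt
  have hφ₂ : ∀ i < n, φ (σ (p i)) = f (i + 1) := by
    intro i hi
    have h0 : ¬ ∃ j < n, p j = σ (p i) := fun ⟨j, _, h⟩ ↦ hpσ _ _ h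
    have h : ∃ j < n, σ (p j) = σ (p i) := ⟨i, hi, rfl⟩
    have h2 := h.choose_spec
    simp only [φ]
    rw [dif_neg h0, dif_pos h, hpinj _ h2.1 _ hi (hσ.injective h2.2)]
  have hτp : ∀ i < n, τ (p i) = σ (p (if i = 0 then n - 1 else i - 1)) := by
    intro i hi
    split_ifs with h
    · subst h
      rw [← hpn, show n = n - 1 + 1 by omega, hps, hτ, Nat.add_sub_cancel]
    · conv_lhs => rw [show i = i - 1 + 1 by omega, hps, hτ]
  have hmem : ∀ y, y ∈ orbitDarts σ τ d ↔ ∃ i < n, y = p i ∨ y = σ (p i) := by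
    intro y
    simp only [orbitDarts, mem_union, mem_image, mem_range, ← hn]
    constructor
    · rintro (⟨i, hi, rfl⟩ | ⟨i, hi, rfl⟩)
      exacts [⟨i, hi, .inl rfl⟩, ⟨i, hi, .inr rfl⟩]
    · rintro ⟨i, hi, rfl | rfl⟩
      exacts [.inl ⟨i, hi, rfl⟩, .inr ⟨i, hi, rfl⟩]
  have hvalid : ∀ y ∈ orbitDarts σ τ d, (it y).valid (φ y) (φ (σ y)) = true := by
    intro y hy
    obtain ⟨i, hi, rfl | rfl⟩ := (hmem y).1 hy
    · rw [hφ₁ i hi.le, hφ₂ i hi]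
      exact (hval i hi).1
    · rw [hit, hσ, hφ₁ i hi.le, hφ₂ i hi]
      exact valid_comm _ _ _ (hval i hi).1
  have hτmem : ∀ y ∈ orbitDarts σ τ d, τ y ∈ orbitDarts σ τ d := by
    intro y hy
    obtain ⟨i, hi, rfl | rfl⟩ := (hmem y).1 hy
    · refine (hmem _).2 ⟨if i = 0 then n - 1 else i - 1, ?_, .inr (hτp i hi)⟩
      split_ifs <;> omega
    · rcases (show i + 1 ≤ n from hi).eq_or_lt with h | h
      · exact (hmem _).2 ⟨0, hd, .inl (by rw [← hps, h, hpn])⟩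
      · exact (hmem _).2 ⟨i + 1, h, .inl (hps i).symm⟩
  refine ⟨φ, fun y hy ↦ ⟨?_, hvalid y hy⟩, ?_⟩
  · obtain ⟨i, hi, rfl | rfl⟩ := (hmem y).1 hy
    · rw [hτp i hi, hφ₂ _ (by split_ifs <;> omega), hφ₁ i hi.le]
      split_ifs with h
      · rw [h, hf0, ← hfn]
        congr 1
        omega
      · congr 1
        omega
    · rw [← hps, hφ₁ _ hi, hφ₂ i hi]
  · set o : D → ℕ := fun y ↦ (it y).others (φ y) (φ (σ y)) with ho
    have ho127 : ∀ y ∈ orbitDarts σ τ d, o y ≠ 127 := fun y hy ↦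
      others_ne (hvalid y hy) (he y) (hc y)
    have hdisj : Disjoint ((range n).image p) ((range n).image fun i ↦ σ (p i)) := by
      rw [Finset.disjoint_left]
      intro y hy hy'
      obtain ⟨i, -, rfl⟩ := mem_image.1 hy
      obtain ⟨j, -, h⟩ := mem_image.1 hy'
      exact hpσ _ _ h.symm
    have hO : orbitDarts σ τ d = (range n).image p ∪ (range n).image fun i ↦ σ (p i) := rfl
    have hinj₁ : Set.InjOn p (range n : Finset ℕ) := fun i hi j hj h ↦
      hpinj i (by simpa using hi) j (by simpa using hj) h
    have hinj₂ : Set.InjOn (fun i ↦ σ (p i)) (range n : Finset ℕ) := fun i hi j hj h ↦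
      hpinj i (by simpa using hi) j (by simpa using hj) (hσ.injective h)
    have hcard : #(orbitDarts σ τ d) = n + n := by
      rw [hO, card_union_of_disjoint hdisj, card_image_of_injOn hinj₁, card_image_of_injOn hinj₂,
        card_range]
    have hclash : ∀ i < n, clash (o (τ (p i))) (o (p i)) =
        clash (r i) ((it (p i)).others (f i) (f (i + 1))) := by
      intro i hi
      have h1 : o (p i) = (it (p i)).others (f i) (f (i + 1)) := by
        simp only [ho]
        rw [hφ₁ i hi.le, hφ₂ i hi]
      have h2 : o (τ (p i)) = r i := by
        have h3 : (if i = 0 then n - 1 else i - 1) < n := by split_ifs <;> omega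
        rw [hτp i hi]
        simp only [ho]
        rw [hit, hσ, hφ₂ _ h3, hφ₁ _ h3.le, ← (hval _ h3).2]
        split_ifs with h
        · rw [h, hr0, ← hrn]
          congr 1
          omega
        · congr 1
          omega
      rw [h1, h2]
    have hsum₁ : ∑ i ∈ range n, charge σ τ it φ (p i) ≤ n := by
      refine le_trans (le_of_eq ?_) hsum
      rw [zero_add, ← Finset.range_eq_Ico]
      refine Finset.sum_congr rfl fun i hi ↦ ?_
      rw [mem_range] at hi
      rw [← hclash i hi, charge, hφ₁ i hi.le, hφ₂ i hi]
      congr 1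
      simp only [ho]
      rw [hφ₁ i hi.le, hφ₂ i hi]
    -- Costs are symmetric in the two colors. The edge of `σ (p i)` is the edge of `p (i + 1)`, and
    -- since `p n = p 0` this cyclic shift does not change the sum.
    have hsum₂ : ∑ i ∈ range n, charge σ τ it φ (σ (p i)) = ∑ i ∈ range n, charge σ τ it φ (p i) := by
      have h1 : ∀ y, charge σ τ it φ y = (it y).cost (φ y) (φ (σ y)) + clash (o (τ y)) (o y) :=
        fun y ↦ rfl
      simp only [h1, Finset.sum_add_distrib]
      congr 1
      · refine Finset.sum_congr rfl fun i hi ↦ ?_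
        rw [hit, hσ, cost_comm]
      · have h2 : ∀ i ∈ range n, clash (o (τ (σ (p i)))) (o (σ (p i))) =
            clash (o (τ (p (i + 1)))) (o (p (i + 1))) := by
          intro i hi
          rw [mem_range] at hi
          have hy : σ (p i) ∈ orbitDarts σ τ d := (hmem _).2 ⟨i, hi, .inr rfl⟩
          rw [hps, hτ, clash_comm (ho127 _ (hτmem _ hy)) (ho127 _ hy)]
        rw [Finset.sum_congr rfl h2]
        have h3 := Finset.sum_range_succ (fun i ↦ clash (o (τ (p i))) (o (p i))) n
        have h4 := Finset.sum_range_succ' (fun i ↦ clash (o (τ (p i))) (o (p i))) n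
        rw [hpn] at h3
        omega
    rw [hcard, hO, sum_union hdisj, sum_image hinj₁, sum_image hinj₂, hsum₂]
    exact add_le_add hsum₁ hsum₁

theorem minimalPeriod_comp_pos [Finite D] (hσ : Involutive σ) (hτ : Involutive τ) (d : D) :
    0 < minimalPeriod (τ ∘ σ) d :=
  minimalPeriod_pos_of_mem_periodicPts ((hτ.injective.comp hσ.injective).mem_periodicPts d)

theorem self_mem_orbitDarts [Finite D] [DecidableEq D] (hσ : Involutive σ) (hτ : Involutive τ)
    (d : D) : d ∈ orbitDarts σ τ d := by
  simp only [orbitDarts, mem_union, mem_image, mem_range]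
  exact .inl ⟨0, minimalPeriod_comp_pos hσ hτ d, rfl⟩

theorem apply_mem_orbitDarts [Finite D] [DecidableEq D] (hσ : Involutive σ) (hτ : Involutive τ)
    {d y : D} (hy : y ∈ orbitDarts σ τ d) :
    τ y ∈ orbitDarts σ τ d ∧ σ y ∈ orbitDarts σ τ d := by
  have hd := minimalPeriod_comp_pos hσ hτ d
  simp only [orbitDarts, mem_union, mem_image, mem_range] at hy ⊢
  have hpn : (τ ∘ σ)^[minimalPeriod (τ ∘ σ) d] d = d := iterate_minimalPeriod
  generalize minimalPeriod (τ ∘ σ) d = n at *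
  rcases hy with ⟨i, hi, rfl⟩ | ⟨i, hi, rfl⟩
  · refine ⟨.inr ?_, .inr ⟨i, hi, rfl⟩⟩
    rcases i with _ | i
    · refine ⟨n - 1, by omega, ?_⟩
      conv_rhs => rw [iterate_zero, id, ← hpn, show n = n - 1 + 1 by omega, iterate_succ_apply',
        comp_apply, hτ]
    · exact ⟨i, by omega, by rw [iterate_succ_apply', comp_apply, hτ]⟩
  · refine ⟨.inl ?_, .inl ⟨i, hi, by rw [hσ]⟩⟩
    rcases (show i + 1 ≤ n from hi).eq_or_lt with h | h
    · refine ⟨0, hd, ?_⟩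
      change d = (τ ∘ σ) ((τ ∘ σ)^[i] d)
      rw [← iterate_succ_apply' (τ ∘ σ), Nat.succ_eq_add_one, h, hpn]
    · exact ⟨i + 1, h, by rw [iterate_succ_apply', comp_apply]⟩

theorem orbitDarts_subset [DecidableEq D] {S : Finset D} (hS : ∀ y ∈ S, τ y ∈ S ∧ σ y ∈ S) {d : D}
    (hd : d ∈ S) : orbitDarts σ τ d ⊆ S := by
  have hit : ∀ i, (τ ∘ σ)^[i] d ∈ S := by
    intro i
    induction i with
    | zero => exact hd
    | succ i ih =>
      rw [iterate_succ_apply']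
      exact (hS _ (hS _ ih).2).1
  intro y hy
  simp only [orbitDarts, mem_union, mem_image, mem_range] at hy
  rcases hy with ⟨i, -, rfl⟩ | ⟨i, -, rfl⟩
  exacts [hit i, (hS _ (hit i)).2]

/-- Orbits are removed one at a time from a set stable under σ and τ. Charges never involve darts of
two different orbits. -/
theorem exists_coloring_of_closed [Fintype D] [DecidableEq D] (hσ : Involutive σ) (hτ : Involutive τ)
    (hσ0 : ∀ d, σ d ≠ d) (hτ0 : ∀ d, τ d ≠ d) {it : D → CoreItem} (hit : ∀ d, it (σ d) = it d)
    (he : ∀ d e x, it d = vertex e x → e < 5) (hc : ∀ d c, it d = edge c → c < 5)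
    (hcl : ∀ d, ∃ d' ∈ orbitDarts σ τ d, Closed (cycleItems σ τ it d')) :
    ∃ φ : D → ℕ, (∀ y, φ (τ y) = φ y) ∧ (∀ y, (it y).valid (φ y) (φ (σ y)) = true) ∧
      ∑ y, charge σ τ it φ y ≤ Fintype.card D := by
  classical
  have key : ∀ k, ∀ S : Finset D, #S = k → (∀ y ∈ S, τ y ∈ S ∧ σ y ∈ S) →
      ∃ φ : D → ℕ, (∀ y ∈ S, φ (τ y) = φ y ∧ (it y).valid (φ y) (φ (σ y)) = true) ∧
        ∑ y ∈ S, charge σ τ it φ y ≤ #S := by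
    intro k
    induction k using Nat.strong_induction_on with
    | _ k ih =>
      intro S hk hS
      rcases S.eq_empty_or_nonempty with rfl | ⟨d₀, hd₀⟩
      · exact ⟨fun _ ↦ 0, by simp, by simp⟩
      obtain ⟨d, hd, hdcl⟩ := hcl d₀
      replace hd := orbitDarts_subset hS hd₀ hd
      have hOS : orbitDarts σ τ d ⊆ S := orbitDarts_subset hS hd
      have hdO := self_mem_orbitDarts hσ hτ d
      have hS' : ∀ y ∈ S \ orbitDarts σ τ d,
          τ y ∈ S \ orbitDarts σ τ d ∧ σ y ∈ S \ orbitDarts σ τ d := by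
        intro y hy
        rw [mem_sdiff] at hy
        refine ⟨mem_sdiff.2 ⟨(hS y hy.1).1, fun h ↦ hy.2 ?_⟩,
          mem_sdiff.2 ⟨(hS y hy.1).2, fun h ↦ hy.2 ?_⟩⟩
        · simpa [hτ y] using (apply_mem_orbitDarts hσ hτ h).1
        · simpa [hσ y] using (apply_mem_orbitDarts hσ hτ h).2
      have hlt : #(S \ orbitDarts σ τ d) < k := by
        rw [← hk]
        exact card_lt_card (sdiff_ssubset hOS ⟨d, hdO⟩)
      obtain ⟨φ₁, h₁, h₁'⟩ := ih _ hlt (S \ orbitDarts σ τ d) rfl hS'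
      obtain ⟨φ₂, h₂, h₂'⟩ := exists_orbit_coloring hσ hτ hσ0 hτ0 hit he hc
        (minimalPeriod_comp_pos hσ hτ d) hdcl
      set φ : D → ℕ := fun y ↦ if y ∈ orbitDarts σ τ d then φ₂ y else φ₁ y with hφ
      have hφ₂ : ∀ y ∈ orbitDarts σ τ d, φ y = φ₂ y := fun y hy ↦ if_pos hy
      have hφ₁ : ∀ y ∈ S \ orbitDarts σ τ d, φ y = φ₁ y := fun y hy ↦
        if_neg (mem_sdiff.1 hy).2
      refine ⟨φ, fun y hy ↦ ?_, ?_⟩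
      · by_cases hyO : y ∈ orbitDarts σ τ d
        · rw [hφ₂ _ hyO, hφ₂ _ (apply_mem_orbitDarts hσ hτ hyO).1, hφ₂ _ (apply_mem_orbitDarts hσ hτ hyO).2]
          exact h₂ y hyO
        · have hy' := mem_sdiff.2 ⟨hy, hyO⟩
          rw [hφ₁ _ hy', hφ₁ _ (hS' y hy').1, hφ₁ _ (hS' y hy').2]
          exact h₁ y hy'
      · rw [← Finset.sum_sdiff hOS, ← card_sdiff_add_card_eq_card hOS]
        refine add_le_add (le_trans (le_of_eq ?_) h₁') (le_trans (le_of_eq ?_) h₂')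
        · refine Finset.sum_congr rfl fun y hy ↦ ?_
          have hτy := (hS' y hy).1
          simp only [charge]
          rw [hφ₁ _ hy, hφ₁ _ hτy, hφ₁ _ (hS' y hy).2, hφ₁ _ (hS' _ hτy).2]
        · refine Finset.sum_congr rfl fun y hy ↦ ?_
          have hτy := (apply_mem_orbitDarts hσ hτ hy).1
          simp only [charge]
          rw [hφ₂ _ hy, hφ₂ _ hτy, hφ₂ _ (apply_mem_orbitDarts hσ hτ hy).2, hφ₂ _ (apply_mem_orbitDarts hσ hτ hτy).2]
  obtain ⟨φ, h, hsum⟩ := key _ univ rfl (by simp)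
  exact ⟨φ, fun y ↦ (h y (mem_univ y)).1, fun y ↦ (h y (mem_univ y)).2, hsum⟩

end Orbit

end CoreItem

open Function

/-- The darts of the cycles of `E₀ ∪ E₂`: `σ d` is the other dart at the item (vertex or edge) of
`d`, and `τ d` is the other dart of the edge of `d`. The item of `d` is labelled by an edge of
`E₃`, or by the color of its pendent edges. -/
structure CoreDarts (D κ : Type*) where
  σ : D → D
  τ : D → D
  σ_invol : Involutive σ
  τ_invol : Involutive τ
  σ_ne : ∀ d, σ d ≠ d
  τ_ne : ∀ d, τ d ≠ d
  label : D → κ ⊕ ℕ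
  label_σ : ∀ d, label (σ d) = label d
  label_lt : ∀ d c, label d = .inr c → c < 3
  τ_ne_σ : ∀ d e, label d = .inl e → τ d ≠ σ d
  ends : ∀ e, ∃ d₁ d₂, ∀ d, label d = .inl e → d = d₁ ∨ d = σ d₁ ∨ d = d₂ ∨ d = σ d₂

/-! ### Exceptional cycles, a maximal set of E₃ edges joining them, and targets. -/

namespace CoreDarts

variable {D κ : Type*} (A : CoreDarts D κ)

/-- The next dart around the cycle. -/
def next : D → D := A.τ ∘ A.σ

/-- The cycle of a dart. -/
def cyc (d : D) : Quot fun d d' ↦ d' = A.σ d ∨ d' = A.τ d := Quot.mk _ d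

theorem cyc_σ (d : D) : A.cyc (A.σ d) = A.cyc d := (Quot.sound (.inl rfl)).symm

theorem cyc_τ (d : D) : A.cyc (A.τ d) = A.cyc d := (Quot.sound (.inr rfl)).symm

theorem cyc_next (d : D) : A.cyc (A.next d) = A.cyc d := (A.cyc_τ _).trans (A.cyc_σ _)

theorem cyc_iterate (i : ℕ) (d : D) : A.cyc (A.next^[i] d) = A.cyc d := by
  induction i with
  | zero => rfl
  | succ i ih => rw [iterate_succ_apply', cyc_next, ih]

theorem mem_orbitDarts_of_cyc_eq [Finite D] [DecidableEq D] {d d' : D} (h : A.cyc d = A.cyc d') :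
    d' ∈ CoreItem.orbitDarts A.σ A.τ d := by
  have key : ∀ a b, Relation.EqvGen (fun d d' ↦ d' = A.σ d ∨ d' = A.τ d) a b →
      (a ∈ CoreItem.orbitDarts A.σ A.τ d ↔ b ∈ CoreItem.orbitDarts A.σ A.τ d) := by
    intro a b hab
    induction hab with
    | rel a b hab =>
      have h1 := fun y (hy : y ∈ CoreItem.orbitDarts A.σ A.τ d) ↦
        CoreItem.apply_mem_orbitDarts A.σ_invol A.τ_invol hy
      rcases hab with rfl | rfl
      · exact ⟨fun h ↦ (h1 _ h).2, fun h ↦ by simpa [A.σ_invol a] using (h1 _ h).2⟩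
      · exact ⟨fun h ↦ (h1 _ h).1, fun h ↦ by simpa [A.τ_invol a] using (h1 _ h).1⟩
    | refl a => rfl
    | symm a b _ ih => exact ih.symm
    | trans a b c _ _ ih₁ ih₂ => exact ih₁.trans ih₂
  exact (key _ _ (Quot.eqvGen_exact h)).1 (CoreItem.self_mem_orbitDarts A.σ_invol A.τ_invol d)

theorem exists_of_cyc_eq [Finite D] {d d' : D} (h : A.cyc d = A.cyc d') :
    ∃ i < minimalPeriod A.next d, d' = A.next^[i] d ∨ d' = A.σ (A.next^[i] d) := by
  classical
  have := A.mem_orbitDarts_of_cyc_eq h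
  simp only [CoreItem.orbitDarts, Finset.mem_union, Finset.mem_image, Finset.mem_range] at this
  rcases this with ⟨i, hi, rfl⟩ | ⟨i, hi, rfl⟩
  exacts [⟨i, hi, .inl rfl⟩, ⟨i, hi, .inr rfl⟩]

/-- `d` lies on a triangle all vertices of which are on edges of `E₃`. -/
def IsTriangle (d : D) : Prop :=
  minimalPeriod A.next d = 3 ∧ ∀ i, ∃ e, A.label (A.next^[i] d) = .inl e

/-- `d` is at the vertex `e` of a triangle consisting of an edge of `E₂` with pendent color `c`
and two edges of `E₀`. -/
def IsDigon (d : D) (e : κ) (c : ℕ) : Prop :=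
  minimalPeriod A.next d = 2 ∧ A.label d = .inl e ∧ A.label (A.next d) = .inr c

theorem IsTriangle.exists_label [Finite D] {d d' : D} (h : A.IsTriangle d)
    (hd : A.cyc d = A.cyc d') : ∃ i < 3, A.label d' = A.label (A.next^[i] d) := by
  obtain ⟨i, hi, rfl | rfl⟩ := A.exists_of_cyc_eq hd
  · exact ⟨i, h.1 ▸ hi, rfl⟩
  · exact ⟨i, h.1 ▸ hi, A.label_σ _⟩

theorem IsDigon.label_eq [Finite D] {d d' : D} {e : κ} {c : ℕ} (h : A.IsDigon d e c)
    (hd : A.cyc d = A.cyc d') : A.label d' = .inl e ∨ A.label d' = .inr c := by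
  obtain ⟨i, hi, hi'⟩ := A.exists_of_cyc_eq hd
  have h1 : A.label d' = A.label (A.next^[i] d) := by
    rcases hi' with rfl | rfl
    exacts [rfl, A.label_σ _]
  rw [h.1] at hi
  interval_cases i
  · exact .inl (h1.trans h.2.1)
  · exact .inr (h1.trans h.2.2)

theorem IsTriangle.not_isDigon [Finite D] {d d' : D} {e : κ} {c : ℕ} (h : A.IsTriangle d)
    (hd : A.cyc d = A.cyc d') : ¬ A.IsDigon d' e c := by
  intro h'
  obtain ⟨i, -, hi⟩ := h.exists_label A (hd.trans (A.cyc_next d').symm)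
  obtain ⟨f, hf⟩ := h.2 i
  rw [h'.2.2, hf] at hi
  simp at hi

/-- The cycle of `d` is a triangle or a digon. -/
def IsSpecial (d : D) : Prop :=
  (∃ d', A.cyc d' = A.cyc d ∧ A.IsTriangle d') ∨
    ∃ d' e c, A.cyc d' = A.cyc d ∧ A.IsDigon d' e c

/-- The edges in `N` join special cycles, and distinct ones have no cycle in common. -/
def IsSpecialMatching (N : Set κ) : Prop :=
  (∀ e ∈ N, ∀ d, A.label d = .inl e → A.IsSpecial d) ∧
    ∀ e ∈ N, ∀ e' ∈ N, ∀ d d', A.label d = .inl e → A.label d' = .inl e' →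
      A.cyc d = A.cyc d' → e = e'

/-- The cycle of `d` is a triangle without an edge in `N`. -/
def IsFree (N : Set κ) (d : D) : Prop :=
  (∃ d', A.cyc d' = A.cyc d ∧ A.IsTriangle d') ∧
    ∀ d', A.cyc d' = A.cyc d → ∀ e, A.label d' = .inl e → e ∉ N

theorem exists_maximal_isSpecialMatching [Finite κ] :
    ∃ N : Set κ, Maximal A.IsSpecialMatching N := by
  obtain ⟨N, hN⟩ := (Set.toFinite {N : Set κ | A.IsSpecialMatching N}).exists_maximal
    ⟨∅, by simp, by simp⟩
  exact ⟨N, hN⟩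

/-- If every end of e were on a special cycle not met by N, then e could be added to N. So some end
is on a cycle that is not special or is met by N; the free triangle of `d` is neither, hence this
end is elsewhere and makes no demand on the target of e. -/
theorem IsFree.exists_other_end [Finite D] {N : Set κ} (hN : Maximal A.IsSpecialMatching N)
    {d : D} {e : κ} (hd : A.IsFree N d) (he : A.label d = .inl e) :
    ∃ d', A.cyc d' ≠ A.cyc d ∧ ¬ A.IsFree N d' ∧
      (∀ y e' c, A.cyc y = A.cyc d' → ¬ A.IsDigon y e' c) ∧
      ∀ y, A.label y = .inl e → y = d ∨ y = A.σ d ∨ y = d' ∨ y = A.σ d' := by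
  have heN : e ∉ N := hd.2 d rfl e he
  obtain ⟨d', hd', hb⟩ : ∃ d', A.label d' = .inl e ∧ (A.IsSpecial d' →
      ∃ y e', e' ∈ N ∧ A.cyc y = A.cyc d' ∧ A.label y = .inl e') := by
    by_contra! hcon
    refine heN (hN.2 (y := insert e N) ⟨?_, ?_⟩ (Set.subset_insert e N) (Set.mem_insert e N))
    · rintro f (rfl | hf) y hy
      · exact (hcon y hy).1
      · exact hN.1.1 f hf y hy
    · rintro f (rfl | hf) f' (rfl | hf') y y' hy hy' hyy'
      · rfl
      · exact absurd hy' ((hcon y hy).2 y' f' hf' hyy'.symm)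
      · exact absurd hy ((hcon y' hy').2 y f hf hyy')
      · exact hN.1.2 f hf f' hf' y y' hy hy' hyy'
  have hfree : ¬ A.IsFree N d' := by
    rintro ⟨h1, h2⟩
    obtain ⟨y, e', he', hy, hye⟩ := hb (.inl h1)
    exact h2 y hy e' hye he'
  have hcyc : A.cyc d' ≠ A.cyc d := by
    intro h
    apply hfree
    unfold IsFree
    rw [h]
    exact hd
  refine ⟨d', hcyc, hfree, ?_, ?_⟩
  · intro y e' c hy hdig
    -- A digon carries a single edge of E₃, so an edge of N on it would be e itself.
    obtain ⟨z, f, hf, hz, hzf⟩ := hb (.inr ⟨y, e', c, hy, hdig⟩)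
    have h1 := hdig.label_eq A hy
    have h2 := hdig.label_eq A (hy.trans hz.symm)
    rw [hd'] at h1
    rw [hzf] at h2
    simp only [Sum.inl.injEq, reduceCtorEq, or_false] at h1 h2
    exact heN (h1.trans h2.symm ▸ hf)
  · have hne₁ : d' ≠ d := fun h ↦ hcyc (by rw [h])
    have hne₂ : d' ≠ A.σ d := fun h ↦ hcyc (by rw [h, cyc_σ])
    have hne₃ : A.σ d' ≠ d := fun h ↦ hcyc (by rw [← h, cyc_σ])
    obtain ⟨d₁, d₂, h12⟩ := A.ends e
    have hσσ := A.σ_invol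
    intro y hy
    rcases h12 d he with rfl | rfl | rfl | rfl <;>
      rcases h12 d' hd' with rfl | rfl | rfl | rfl <;>
      rcases h12 y hy with rfl | rfl | rfl | rfl <;> simp_all [hσσ _]

open Classical in
/-- The position of the edge `e` among the three edges at a triangle. -/
noncomputable def position (d : D) (e : κ) : ℕ :=
  if A.label d = .inl e then 0 else if A.label (A.next d) = .inl e then 1 else 2

theorem next_iterate_ne [Finite D] {d : D} (h : A.IsTriangle d) {i j : ℕ} (hi : i < 3) (hj : j < 3)
    (hij : i ≠ j) : A.next^[i] d ≠ A.next^[j] d := fun h' ↦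
  hij (iterate_injOn_Iio_minimalPeriod (f := A.next) (x := d) (by simpa [h.1]) (by simpa [h.1]) h')

theorem next_iterate_ne_σ (d : D) (i j : ℕ) : A.next^[i] d ≠ A.σ (A.next^[j] d) :=
  CoreItem.iterate_ne_apply_iterate A.σ_invol A.τ_invol A.σ_ne A.τ_ne d i j

theorem isFree_congr {N : Set κ} {d d' : D} (h : A.cyc d = A.cyc d') :
    A.IsFree N d ↔ A.IsFree N d' := by
  unfold IsFree
  rw [h]

/-- Distinct vertices of a free triangle are on distinct edges of `E₃`. -/
theorem IsFree.label_ne [Finite D] {N : Set κ} (hN : Maximal A.IsSpecialMatching N)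
    {d : D} (hd : A.IsFree N d) (ht : A.IsTriangle d) {i j : ℕ} (hi : i < 3) (hj : j < 3)
    (hij : i ≠ j) : A.label (A.next^[i] d) ≠ A.label (A.next^[j] d) := by
  intro h
  obtain ⟨e, he⟩ := ht.2 i
  obtain ⟨d', hcyc, -, -, hall⟩ :=
    IsFree.exists_other_end A hN ((A.isFree_congr (A.cyc_iterate i d).symm).1 hd) he
  rw [cyc_iterate] at hcyc
  rcases hall _ (h.symm.trans he) with h1 | h1 | h1 | h1
  · exact A.next_iterate_ne ht hj hi hij.symm h1
  · exact A.next_iterate_ne_σ d j i h1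
  · exact hcyc (by rw [← h1, cyc_iterate])
  · exact hcyc (by rw [← A.cyc_σ, ← h1, cyc_iterate])

/-- An edge has two ends, each of which excludes at most one of the three colors. -/
theorem exists_digon_avoiding [Finite D] (e : κ) :
    ∃ v < 3, ∀ d c, A.IsDigon d e c → v ≠ c := by
  have hσ : ∀ d c c', A.IsDigon d e c → A.IsDigon (A.σ d) e c' → c = c' := by
    intro d c c' h h'
    have h1 : A.cyc d = A.cyc (A.next (A.σ d)) := by rw [cyc_next, cyc_σ]
    rcases h.label_eq A h1 with h2 | h2 <;> rw [h'.2.2] at h2 <;> simp_all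
  have huniq : ∀ d c c', A.IsDigon d e c → A.IsDigon d e c' → c = c' := by
    intro d c c' h h'
    have := h.2.2.symm.trans h'.2.2
    simpa using this
  obtain ⟨d₁, d₂, h12⟩ := A.ends e
  have key : ∀ d₀, ∃ b, ∀ d c, (d = d₀ ∨ d = A.σ d₀) → A.IsDigon d e c → c = b := by
    intro d₀
    by_cases h1 : ∃ c, A.IsDigon d₀ e c
    · obtain ⟨c, hc⟩ := h1
      refine ⟨c, ?_⟩
      rintro d c' (rfl | rfl) h
      exacts [huniq _ _ _ h hc, (hσ _ _ _ hc h).symm]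
    by_cases h2 : ∃ c, A.IsDigon (A.σ d₀) e c
    · obtain ⟨c, hc⟩ := h2
      refine ⟨c, ?_⟩
      rintro d c' (rfl | rfl) h
      exacts [absurd ⟨c', h⟩ h1, huniq _ _ _ h hc]
    · refine ⟨0, ?_⟩
      rintro d c' (rfl | rfl) h
      exacts [absurd ⟨c', h⟩ h1, absurd ⟨c', h⟩ h2]
  obtain ⟨b₁, hb₁⟩ := key d₁
  obtain ⟨b₂, hb₂⟩ := key d₂
  have hv : ∃ v < 3, v ≠ b₁ ∧ v ≠ b₂ := by
    by_cases h0 : 0 ≠ b₁ ∧ 0 ≠ b₂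
    · exact ⟨0, by norm_num, h0⟩
    by_cases h1 : 1 ≠ b₁ ∧ 1 ≠ b₂
    · exact ⟨1, by norm_num, h1⟩
    · exact ⟨2, by norm_num, by omega⟩
  obtain ⟨v, hv, hv₁, hv₂⟩ := hv
  refine ⟨v, hv, fun d c hd ↦ ?_⟩
  rcases h12 d hd.2.1 with h | h | h | h
  · exact hb₁ d c (.inl h) hd ▸ hv₁
  · exact hb₁ d c (.inr h) hd ▸ hv₁
  · exact hb₂ d c (.inl h) hd ▸ hv₂
  · exact hb₂ d c (.inr h) hd ▸ hv₂

/-- The targets of the edges of `E₃`: the three edges at a free triangle get distinct targets, and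
the target of the edge at a digon differs from the pendent color. -/
theorem exists_targets [Finite D] {N : Set κ} (hN : Maximal A.IsSpecialMatching N) :
    ∃ x : κ → ℕ, (∀ e, x e < 3) ∧ (∀ d e c, A.IsDigon d e c → x e ≠ c) ∧
      ∀ d, A.IsFree N d → ∃ d', A.cyc d = A.cyc d' ∧ A.IsTriangle d' ∧
        ∀ i < 3, ∀ e, A.label (A.next^[i] d') = .inl e → x e = i := by
  classical
  -- A base dart is fixed for each free triangle, so that positions are counted from the same vertex
  -- whichever dart is used.
  have hrep : ∀ q, ∃ d', (∃ d, A.IsFree N d ∧ A.cyc d = q) → A.IsTriangle d' ∧ A.cyc d' = q ∧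
      A.IsFree N d' := by
    intro q
    by_cases h : ∃ d, A.IsFree N d ∧ A.cyc d = q
    · obtain ⟨d, hd, rfl⟩ := h
      obtain ⟨d', h1, h2⟩ := hd.1
      exact ⟨d', fun _ ↦ ⟨h2, h1, (A.isFree_congr h1).2 hd⟩⟩
    · by_cases hD : Nonempty D
      · exact ⟨hD.some, fun h' ↦ absurd h' h⟩
      · exact q.inductionOn fun d ↦ absurd ⟨d⟩ hD
  choose r hr using hrep
  have hval : ∀ e, ∃ v < 3, (∀ d c, A.IsDigon d e c → v ≠ c) ∧
      ∀ d, A.IsFree N d → A.label d = .inl e → v = A.position (r (A.cyc d)) e := by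
    intro e
    by_cases h : ∃ d, A.IsFree N d ∧ A.label d = .inl e
    · obtain ⟨d, hd, he⟩ := h
      obtain ⟨d', hcyc, hfree, hdig, hall⟩ := IsFree.exists_other_end A hN hd he
      refine ⟨A.position (r (A.cyc d)) e, ?_, ?_, ?_⟩
      · unfold position
        split_ifs <;> norm_num
      · intro y c hy
        exfalso
        obtain ⟨z, hz, ht⟩ := hd.1
        rcases hall y hy.2.1 with rfl | rfl | rfl | rfl
        · exact ht.not_isDigon A hz hy
        · exact ht.not_isDigon A (hz.trans (A.cyc_σ _).symm) hy
        · exact hdig _ _ _ rfl hy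
        · exact hdig _ _ _ (A.cyc_σ _) hy
      · intro y hy hye
        rcases hall y hye with rfl | rfl | rfl | rfl
        · rfl
        · rw [cyc_σ]
        · exact absurd hy hfree
        · exact absurd ((A.isFree_congr (A.cyc_σ _)).1 hy) hfree
    · obtain ⟨v, hv, hv'⟩ := A.exists_digon_avoiding e
      exact ⟨v, hv, hv', fun d hd he ↦ absurd ⟨d, hd, he⟩ h⟩
  choose x hx hx₁ hx₂ using hval
  refine ⟨x, hx, fun d e c h ↦ hx₁ e d c h, fun d hd ↦ ?_⟩
  obtain ⟨ht, hcyc, hfree⟩ := hr (A.cyc d) ⟨d, hd, rfl⟩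
  refine ⟨r (A.cyc d), hcyc.symm, ht, fun i hi e he ↦ ?_⟩
  rw [hx₂ e _ ((A.isFree_congr (A.cyc_iterate i _).symm).1 hfree) he, cyc_iterate, hcyc]
  have hne := fun j (hj : j < 3) (hji : j ≠ i) ↦
    IsFree.label_ne A hN hfree ht hj hi hji
  rw [he] at hne
  have hne₀ := hne 0 (by norm_num)
  have hne₁ := hne 1 (by norm_num)
  simp only [iterate_zero, id, iterate_one] at hne₀ hne₁
  unfold position
  interval_cases i
  · exact if_pos he
  · rw [if_neg (hne₀ (by norm_num))]
    exact if_pos he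
  · rw [if_neg (hne₀ (by norm_num)), if_neg (hne₁ (by norm_num))]

open Classical in
/-- The item of a dart, if the edges of `E₃` in `N` get color `4`, the others color `3`, and `x`
gives the targets. -/
noncomputable def item (N : Set κ) (x : κ → ℕ) (d : D) : CoreItem :=
  match A.label d with
  | .inl e => .vertex (if e ∈ N then 4 else 3) (x e)
  | .inr c => .edge c

theorem item_inl {N : Set κ} {x : κ → ℕ} {d : D} {e : κ} (h : A.label d = .inl e) [Decidable (e ∈ N)] :
    A.item N x d = .vertex (if e ∈ N then 4 else 3) (x e) := by
  unfold item
  rw [h]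
  by_cases he : e ∈ N <;> simp [he]

theorem item_inr {N : Set κ} {x : κ → ℕ} {d : D} {c : ℕ} (h : A.label d = .inr c) :
    A.item N x d = .edge c := by
  unfold item
  rw [h]

end CoreDarts

/-! ### Every cycle is closed for the chosen colors and targets on E₃. -/

namespace CoreItem

theorem exists_eq_flatMap_segment {l : List CoreItem}
    (hl : ∀ i ∈ l, (∃ x < 3, i = vertex 3 x) ∨ ∃ c < 3, i = edge c) :
    ∃ (cs : List ℕ) (S : List (ℕ × List ℕ)), (∀ c ∈ cs, c < 3) ∧ (∀ s ∈ S, SegmentOK s) ∧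
      l = cs.map edge ++ S.flatMap segment := by
  induction l with
  | nil => exact ⟨[], [], by simp, by simp, rfl⟩
  | cons i l ih =>
    obtain ⟨cs, S, hcs, hS, rfl⟩ := ih fun i hi ↦ hl i (List.mem_cons_of_mem _ hi)
    rcases hl i List.mem_cons_self with ⟨x, hx, rfl⟩ | ⟨c, hc, rfl⟩
    · refine ⟨[], (x, cs) :: S, by simp, ?_, rfl⟩
      rintro s (_ | ⟨_, hs⟩)
      exacts [⟨hx, hcs⟩, hS s hs]
    · refine ⟨c :: cs, S, ?_, hS, rfl⟩
      rintro c' (_ | ⟨_, hs⟩)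
      exacts [hc, hcs c' hs]

end CoreItem

namespace CoreDarts

open CoreItem

variable {D κ : Type*} (A : CoreDarts D κ)

theorem minimalPeriod_next_iterate [Finite D] (i : ℕ) (d : D) :
    minimalPeriod A.next (A.next^[i] d) = minimalPeriod A.next d :=
  minimalPeriod_apply_iterate ((A.τ_invol.injective.comp A.σ_invol.injective).mem_periodicPts d) i

theorem minimalPeriod_next_pos [Finite D] (d : D) : 0 < minimalPeriod A.next d :=
  minimalPeriod_comp_pos A.σ_invol A.τ_invol d

variable {A}

theorem IsTriangle.iterate [Finite D] {d : D} (h : A.IsTriangle d) (i : ℕ) :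
    A.IsTriangle (A.next^[i] d) :=
  ⟨(A.minimalPeriod_next_iterate i d).trans h.1, fun j ↦ by
    rw [← iterate_add_apply]
    exact h.2 _⟩

theorem IsTriangle.cycleItems_eq {d : D} (h : A.IsTriangle d) (it : D → CoreItem) :
    cycleItems A.σ A.τ it d = [it d, it (A.next d), it (A.next (A.next d))] := by
  unfold cycleItems
  rw [show minimalPeriod (A.τ ∘ A.σ) d = 3 from h.1]
  rfl

theorem IsTriangle.next_three {d : D} (h : A.IsTriangle d) : A.next (A.next (A.next d)) = d := by
  have := iterate_minimalPeriod (f := A.next) (x := d)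
  rwa [h.1] at this

/-- An edge has only two ends, whereas the triangle has three distinct vertices. -/
theorem IsTriangle.label_ne [Finite D] {d : D} (h : A.IsTriangle d) {e : κ}
    (h₀ : A.label d = .inl e) (h₁ : A.label (A.next d) = .inl e) :
    A.label (A.next (A.next d)) ≠ .inl e := by
  intro h₂
  obtain ⟨d₁, d₂, h12⟩ := A.ends e
  have n01 := A.next_iterate_ne h (i := 0) (j := 1) (by norm_num) (by norm_num) (by norm_num)
  have n02 := A.next_iterate_ne h (i := 0) (j := 2) (by norm_num) (by norm_num) (by norm_num)
  have n12 := A.next_iterate_ne h (i := 1) (j := 2) (by norm_num) (by norm_num) (by norm_num)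
  have s01 := A.next_iterate_ne_σ d 0 1
  have s10 := A.next_iterate_ne_σ d 1 0
  have s02 := A.next_iterate_ne_σ d 0 2
  have s20 := A.next_iterate_ne_σ d 2 0
  have s12 := A.next_iterate_ne_σ d 1 2
  have s21 := A.next_iterate_ne_σ d 2 1
  simp only [iterate_succ_apply, iterate_zero, id] at *
  have k0 := h12 _ h₀
  have k1 := h12 _ h₁
  have k2 := h12 _ h₂
  generalize A.next d = a at *
  generalize A.next a = b at *
  have hσσ := A.σ_invol
  rcases k0 with k0 | k0 | k0 | k0 <;> rcases k1 with k1 | k1 | k1 | k1 <;>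
    rcases k2 with k2 | k2 | k2 | k2 <;> simp_all [hσσ _]

theorem IsDigon.closed {N : Set κ} {x : κ → ℕ} (hx : ∀ e, x e < 3)
    (hxd : ∀ d e c, A.IsDigon d e c → x e ≠ c) {d : D} {e : κ} {c : ℕ} (h : A.IsDigon d e c) :
    Closed (cycleItems A.σ A.τ (A.item N x) d) := by
  classical
  unfold cycleItems
  rw [show minimalPeriod (A.τ ∘ A.σ) d = 2 from h.1]
  change Closed [A.item N x d, A.item N x (A.next d)]
  rw [A.item_inl h.2.1, A.item_inr h.2.2]
  refine closed_of_check (closed_vertex_edge _ (hx e) c (A.label_lt _ _ h.2.2) (hxd d e c h) _ ?_ ?_)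
    (by simp) <;> split_ifs <;> norm_num

/-- Edges of N at the same triangle coincide, so the vertices of color 4 are one or both ends of e.
After a rotation one of the two mixed triangle checks applies. -/
theorem IsTriangle.closed_of_mem [Finite D] {N : Set κ} (hN : A.IsSpecialMatching N) {x : κ → ℕ}
    (hx : ∀ e, x e < 3) {d : D} (h : A.IsTriangle d) {e : κ} (he : A.label d = .inl e)
    (heN : e ∈ N) :
    ∃ d', A.cyc d = A.cyc d' ∧ Closed (cycleItems A.σ A.τ (A.item N x) d') := by
  classical
  obtain ⟨e₁, h₁⟩ := h.2 1
  obtain ⟨e₂, h₂⟩ := h.2 2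
  have k₁ : e₁ ∈ N → e₁ = e := fun hm ↦
    hN.2 e₁ hm e heN _ _ h₁ he (A.cyc_iterate 1 d)
  have k₂ : e₂ ∈ N → e₂ = e := fun hm ↦
    hN.2 e₂ hm e heN _ _ h₂ he (A.cyc_iterate 2 d)
  by_cases m₁ : e₁ ∈ N
  · obtain rfl := k₁ m₁
    by_cases m₂ : e₂ ∈ N
    · obtain rfl := k₂ m₂
      exact absurd h₂ (h.label_ne he h₁)
    · refine ⟨d, rfl, ?_⟩
      rw [h.cycleItems_eq, A.item_inl he, A.item_inl (d := A.next d) h₁,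
        A.item_inl (d := A.next (A.next d)) h₂, if_pos m₁, if_neg m₂]
      exact closed_of_check (closed_triangle_two _ (hx _) _ (hx _)) (by simp)
  · by_cases m₂ : e₂ ∈ N
    · obtain rfl := k₂ m₂
      refine ⟨A.next (A.next d), (A.cyc_iterate 2 d).symm, ?_⟩
      rw [(h.iterate 2).cycleItems_eq (d := A.next (A.next d)), h.next_three,
        A.item_inl he, A.item_inl (d := A.next d) h₁,
        A.item_inl (d := A.next (A.next d)) h₂, if_pos m₂, if_neg m₁]
      exact closed_of_check (closed_triangle_two _ (hx _) _ (hx _)) (by simp)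
    · refine ⟨d, rfl, ?_⟩
      rw [h.cycleItems_eq, A.item_inl he, A.item_inl (d := A.next d) h₁,
        A.item_inl (d := A.next (A.next d)) h₂, if_pos heN, if_neg m₂, if_neg m₁]
      exact closed_of_check (closed_triangle_one _ (hx _) _ (hx _) _ (hx _)) (by simp)

/-- Edges of N occur only on special cycles, so all vertex items here have color 3. Starting at a
vertex, the cycle is a list of segments; without a vertex it is a list of single-edge blocks. -/
theorem closed_of_not_isSpecial [Finite D] {N : Set κ} (hN : A.IsSpecialMatching N) {x : κ → ℕ}
    (hx : ∀ e, x e < 3) {d : D} (hd : ¬ A.IsSpecial d) :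
    ∃ d', A.cyc d = A.cyc d' ∧ Closed (cycleItems A.σ A.τ (A.item N x) d') := by
  classical
  have hsp : ∀ d', A.cyc d' = A.cyc d → ¬ A.IsSpecial d' := by
    intro d' h
    unfold IsSpecial at hd ⊢
    rwa [h]
  have hitem : ∀ i, ∀ d', A.cyc d' = A.cyc d →
      (∃ y < 3, A.item N x (A.next^[i] d') = vertex 3 y) ∨
        ∃ c < 3, A.item N x (A.next^[i] d') = edge c := by
    intro i d' hd'
    rcases hl : A.label (A.next^[i] d') with e | c
    · have heN : e ∉ N := fun heN ↦
        hsp _ ((A.cyc_iterate i d').trans hd') (hN.1 e heN _ hl)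
      exact .inl ⟨x e, hx e, by rw [A.item_inl hl, if_neg heN]⟩
    · exact .inr ⟨c, A.label_lt _ _ hl, A.item_inr hl⟩
  have hlab : ∀ y i z, A.item N x y = vertex i z → ∃ e, A.label y = .inl e := by
    intro y i z hy
    rcases hl : A.label y with e | c
    · exact ⟨e, rfl⟩
    · rw [A.item_inr hl] at hy
      cases hy
  have hlab' : ∀ y c, A.item N x y = edge c → A.label y = .inr c := by
    intro y c hy
    rcases hl : A.label y with e | c
    · rw [A.item_inl hl] at hy
      cases hy
    · rw [A.item_inr hl] at hy
      cases hy
      rfl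
  by_cases hv : ∃ i e, A.label (A.next^[i] d) = .inl e
  · obtain ⟨i, e, he⟩ := hv
    have hcyc := A.cyc_iterate i d
    generalize A.next^[i] d = d' at *
    refine ⟨d', hcyc.symm, ?_⟩
    obtain ⟨cs, S, hcs, hS, hlist⟩ :=
      exists_eq_flatMap_segment (l := cycleItems A.σ A.τ (A.item N x) d') (by
        simp only [cycleItems, List.mem_map]
        rintro _ ⟨j, -, rfl⟩
        exact hitem j d' hcyc)
    have hget : ∀ j (hj : j < minimalPeriod A.next d'),
        (cycleItems A.σ A.τ (A.item N x) d')[j]? = some (A.item N x (A.next^[j] d')) := by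
      intro j hj
      change j < minimalPeriod (A.τ ∘ A.σ) d' at hj
      rw [cycleItems, List.getElem?_map, List.getElem?_range hj]
      rfl
    have hlen : (cycleItems A.σ A.τ (A.item N x) d').length = minimalPeriod A.next d' := by
      simp [cycleItems, next]
    obtain rfl : cs = [] := by
      cases cs with
      | nil => rfl
      | cons c cs =>
        have h0 := hget 0 (A.minimalPeriod_next_pos d')
        rw [hlist] at h0
        simp only [List.map_cons, List.cons_append, List.getElem?_cons_zero, Option.some.injEq] at h0
        rw [iterate_zero, id, A.item_inl he] at h0
        cases h0
    rw [List.map_nil, List.nil_append] at hlist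
    rw [hlist] at hget hlen ⊢
    refine closed_flatMap_segment hS ?_ ?_ ?_
    -- A single vertex item would come from a loop of E₀.
    · rintro y rfl
      have h1 := iterate_minimalPeriod (f := A.next) (x := d')
      rw [← hlen] at h1
      refine A.τ_ne_σ d' e he ?_
      have h2 : A.τ (A.σ d') = d' := h1
      rw [← A.τ_invol (A.σ d'), h2]
    · rintro y c rfl
      have h1 := hget 1 (by rw [← hlen]; simp [CoreItem.segment])
      exact hsp d' hcyc (.inr ⟨d', e, c, rfl, hlen.symm, he, hlab' _ _ (Option.some.inj h1).symm⟩)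
    · rintro y₀ y₁ y₂ rfl
      have h0 := hget 0 (by rw [← hlen]; simp [CoreItem.segment])
      have h1 := hget 1 (by rw [← hlen]; simp [CoreItem.segment])
      have h2 := hget 2 (by rw [← hlen]; simp [CoreItem.segment])
      have hp : minimalPeriod A.next d' = 3 := hlen.symm
      refine hsp d' hcyc (.inl ⟨d', rfl, hp, fun j ↦ ?_⟩)
      rw [← iterate_mod_minimalPeriod_eq, hp]
      have hj := Nat.mod_lt j (show 0 < 3 by norm_num)
      interval_cases j % 3
      · exact hlab _ _ _ (Option.some.inj h0).symm
      · exact hlab _ _ _ (Option.some.inj h1).symm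
      · exact hlab _ _ _ (Option.some.inj h2).symm
  · refine ⟨d, rfl, ?_⟩
    obtain ⟨cs, S, hcs, hS, hlist⟩ :=
      exists_eq_flatMap_segment (l := cycleItems A.σ A.τ (A.item N x) d) (by
        simp only [cycleItems, List.mem_map]
        rintro _ ⟨j, -, rfl⟩
        exact hitem j d rfl)
    cases S with
    | nil =>
      rw [hlist, List.flatMap_nil, List.append_nil]
      exact (block_edges hcs).closed
    | cons s S =>
      exfalso
      have hm : vertex 3 s.1 ∈ cycleItems A.σ A.τ (A.item N x) d := by
        rw [hlist]
        simp [CoreItem.segment]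
      simp only [cycleItems, List.mem_map] at hm
      obtain ⟨j, -, hj⟩ := hm
      obtain ⟨e, he⟩ := hlab _ _ _ hj
      exact hv ⟨j, e, he⟩

variable (A)

/-- Some coloring of the darts has at most as many charges as there are darts. -/
theorem exists_coloring [Fintype D] [Finite κ] : ∃ (N : Set κ) (x : κ → ℕ) (φ : D → ℕ),
    (∀ e, x e < 3) ∧ (∀ y, φ (A.τ y) = φ y) ∧
    (∀ y, (A.item N x y).valid (φ y) (φ (A.σ y)) = true) ∧
    ∑ y, charge A.σ A.τ (A.item N x) φ y ≤ Fintype.card D := by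
  classical
  obtain ⟨N, hN⟩ := A.exists_maximal_isSpecialMatching
  obtain ⟨x, hx, hxd, hxt⟩ := A.exists_targets hN
  obtain ⟨φ, hφ⟩ := exists_coloring_of_closed (it := A.item N x) A.σ_invol A.τ_invol A.σ_ne A.τ_ne
    (fun d ↦ by unfold item; rw [A.label_σ]) (fun d e y h ↦ by
      rcases hl : A.label d with e' | c
      · rw [A.item_inl hl, vertex.injEq] at h
        rw [← h.1]
        split_ifs <;> norm_num
      · rw [A.item_inr hl] at h
        cases h) (fun d c h ↦ by
      rcases hl : A.label d with e' | c'
      · rw [A.item_inl hl] at h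
        cases h
      · rw [A.item_inr hl, edge.injEq] at h
        have := A.label_lt _ _ hl
        omega) (fun d ↦ by
      suffices ∃ d', A.cyc d = A.cyc d' ∧ Closed (cycleItems A.σ A.τ (A.item N x) d') by
        obtain ⟨d', h1, h2⟩ := this
        exact ⟨d', A.mem_orbitDarts_of_cyc_eq h1, h2⟩
      by_cases hs : A.IsSpecial d
      · rcases hs with ⟨d', hcyc, ht⟩ | ⟨d', e, c, hcyc, hd'⟩
        · by_cases hf : A.IsFree N d
          · obtain ⟨d', hcyc, ht, htx⟩ := hxt d hf
            refine ⟨d', hcyc, ?_⟩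
            obtain ⟨e₀, h₀⟩ := ht.2 0
            obtain ⟨e₁, h₁⟩ := ht.2 1
            obtain ⟨e₂, h₂⟩ := ht.2 2
            have m₀ := hf.2 _ ((A.cyc_iterate 0 d').trans hcyc.symm) _ h₀
            have m₁ := hf.2 _ ((A.cyc_iterate 1 d').trans hcyc.symm) _ h₁
            have m₂ := hf.2 _ ((A.cyc_iterate 2 d').trans hcyc.symm) _ h₂
            rw [ht.cycleItems_eq, A.item_inl (d := d') h₀, A.item_inl (d := A.next d') h₁,
              A.item_inl (d := A.next (A.next d')) h₂, if_neg m₀, if_neg m₁, if_neg m₂,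
              htx 0 (by norm_num) _ h₀, htx 1 (by norm_num) _ h₁, htx 2 (by norm_num) _ h₂]
            exact closed_of_check (closed_triangle 0 (by norm_num) 1 (by norm_num) 2 (by norm_num)
              (by norm_num)) (by simp)
          · simp only [IsFree, not_and, not_forall, not_not] at hf
            obtain ⟨y, hy, e, he, heN⟩ := hf ⟨d', hcyc, ht⟩
            obtain ⟨i, hi, hlab⟩ := ht.exists_label A (hcyc.trans hy.symm)
            obtain ⟨z, hz, hcl⟩ := (ht.iterate i).closed_of_mem hN.1 hx (hlab.symm.trans he) heN
            exact ⟨z, by rw [← hz, cyc_iterate, hcyc], hcl⟩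
        · exact ⟨d', hcyc.symm, hd'.closed hx hxd⟩
      · exact closed_of_not_isSpecial hN.1 hx hs)
  exact ⟨N, x, φ, hx, hφ⟩

end CoreDarts

/-! ### Local structure of three 1-factors, and the darts of the uncovered edges. -/

namespace Graph

variable {α β : Type*} {G : Graph α β} {M : Fin 3 → Set β}

/-- `a`, `b` and `c` are the edges at `v`. -/
def EdgesAt (G : Graph α β) (v : α) (a b c : β) : Prop :=
  a ≠ b ∧ a ≠ c ∧ b ≠ c ∧ ∀ e, G.Inc e v ↔ e = a ∨ e = b ∨ e = c

open Classical in
/-- The indices of the sets `M i` which contain `e`. -/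
noncomputable def indices (M : Fin 3 → Set β) (e : β) : Finset (Fin 3) := {i | e ∈ M i}

theorem mem_indices {e : β} {i : Fin 3} : i ∈ indices M e ↔ e ∈ M i := by simp [indices]

theorem empty_ne_compl_singleton : ∀ c : Fin 3, (∅ : Finset (Fin 3)) ≠ {c}ᶜ := by decide

theorem univ_ne_compl_singleton : ∀ c : Fin 3, (Finset.univ : Finset (Fin 3)) ≠ {c}ᶜ := by decide

theorem singleton_ne_compl_singleton : ∀ c d : Fin 3, ({c} : Finset (Fin 3)) ≠ {d}ᶜ := by decide

theorem singleton_ne_univ : ∀ c : Fin 3, ({c} : Finset (Fin 3)) ≠ Finset.univ := by decide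

/-- The sets `M i` are 1-factors of the loopless cubic graph `G`. -/
structure IsFactorTriple (G : Graph α β) (M : Fin 3 → Set β) : Prop where
  not_isLoopAt : ∀ e x, ¬ G.IsLoopAt e x
  ncard_incidenceSet : ∀ x ∈ V(G), (G.incidenceSet x).ncard = 3
  isOneFactor : ∀ i, G.IsOneFactor (M i)

namespace IsFactorTriple

variable (H : G.IsFactorTriple M)

include H

theorem ne_of_isLink {e : β} {x y : α} (h : G.IsLink e x y) : x ≠ y := by
  rintro rfl
  exact H.not_isLoopAt e x h

theorem edgesAt {v : α} {a b c : β} (ha : G.Inc a v) (hb : G.Inc b v) (hc : G.Inc c v)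
    (hab : a ≠ b) (hac : a ≠ c) (hbc : b ≠ c) : G.EdgesAt v a b c := by
  have h3 := H.ncard_incidenceSet v ha.vertex_mem
  have hfin : (G.incidenceSet v).Finite := Set.finite_of_ncard_pos (by omega)
  have hsub : ({a, b, c} : Set β) ⊆ G.incidenceSet v := by
    rintro e (rfl | rfl | rfl) <;> assumption
  have heq := Set.eq_of_subset_of_ncard_le hsub (by
    rw [h3, Set.ncard_eq_three.2 ⟨a, b, c, hab, hac, hbc, rfl⟩]) hfin
  refine ⟨hab, hac, hbc, fun e ↦ ?_⟩
  rw [← mem_incidenceSet, ← heq]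
  simp

theorem exists_third {v : α} {a b : β} (ha : G.Inc a v) (hb : G.Inc b v) (hab : a ≠ b) :
    ∃ c, G.EdgesAt v a b c := by
  have h3 := H.ncard_incidenceSet v ha.vertex_mem
  obtain ⟨x, y, z, hxy, hxz, hyz, hI⟩ := Set.ncard_eq_three.1 h3
  have hI' : ∀ e, G.Inc e v ↔ e = x ∨ e = y ∨ e = z := fun e ↦ by
    rw [← mem_incidenceSet, hI]
    simp
  obtain ⟨c, hc, hca, hcb⟩ : ∃ c, G.Inc c v ∧ c ≠ a ∧ c ≠ b := by
    by_contra! hcon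
    have hx := hcon x ((hI' x).2 (.inl rfl))
    have hy := hcon y ((hI' y).2 (.inr (.inl rfl)))
    have hz := hcon z ((hI' z).2 (.inr (.inr rfl)))
    grind
  exact ⟨c, H.edgesAt ha hb hc hab hca.symm hcb.symm⟩

theorem eq_of_mem {v : α} {i : Fin 3} {a b : β} (ha : G.Inc a v) (hb : G.Inc b v)
    (ha' : i ∈ indices M a) (hb' : i ∈ indices M b) : a = b :=
  ((H.isOneFactor i).existsUnique v ha.vertex_mem).unique ⟨mem_indices.1 ha', ha⟩
    ⟨mem_indices.1 hb', hb⟩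

theorem exists_mem {v : α} (hv : v ∈ V(G)) (i : Fin 3) : ∃ e, G.Inc e v ∧ i ∈ indices M e := by
  obtain ⟨e, ⟨h1, h2⟩, -⟩ := (H.isOneFactor i).existsUnique v hv
  exact ⟨e, h2, mem_indices.2 h1⟩

theorem exists_pendent {v : α} {f h : β} {c : Fin 3} (hf : G.Inc f v) (hh : G.Inc h v)
    (hf' : indices M f = ∅) (hh' : indices M h = {c}ᶜ) :
    ∃ p, G.EdgesAt v f p h ∧ indices M p = {c} := by
  obtain ⟨p, hp, hpc⟩ := H.exists_mem hf.vertex_mem c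
  have hph : p ≠ h := by
    rintro rfl
    simp [hh'] at hpc
  have hpf : f ≠ p := by
    rintro rfl
    simp [hf'] at hpc
  have hfh : f ≠ h := by
    rintro rfl
    exact empty_ne_compl_singleton c (hf'.symm.trans hh')
  refine ⟨p, H.edgesAt hf hp hh hpf hfh hph, ?_⟩
  ext j
  rw [Finset.mem_singleton]
  constructor
  · intro hj
    by_contra hjc
    exact hph (H.eq_of_mem hp hh hj (by simpa [hh'] using hjc))
  · rintro rfl
    exact hpc

/-- The cases are those where the members of the three 1-factors at v coincide, where exactly two of
them do, and where they are distinct. -/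
theorem vertex_cases {v : α} (hv : v ∈ V(G)) :
    (∃ f f' e, G.EdgesAt v f f' e ∧ indices M f = ∅ ∧ indices M f' = ∅ ∧
      indices M e = Finset.univ) ∨
    (∃ f p h c, G.EdgesAt v f p h ∧ indices M f = ∅ ∧ indices M p = {c} ∧ indices M h = {c}ᶜ) ∨
    ∃ a₀ a₁ a₂, G.EdgesAt v a₀ a₁ a₂ ∧ indices M a₀ = {0} ∧ indices M a₁ = {1} ∧
      indices M a₂ = {2} := by
  choose g hg hgi using H.exists_mem hv
  have hiff : ∀ e, G.Inc e v → ∀ i, i ∈ indices M e ↔ g i = e := fun e he i ↦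
    ⟨fun h ↦ H.eq_of_mem (hg i) he (hgi i) h, fun h ↦ h ▸ hgi i⟩
  have hfew : ∀ c d e, c ≠ d → e ≠ c → e ≠ d → g d = g e → g c ≠ g d →
      ∃ f p h c, G.EdgesAt v f p h ∧ indices M f = ∅ ∧ indices M p = {c} ∧
        indices M h = {c}ᶜ := by
    intro c d e hcd hec hed h1 h2
    obtain ⟨f, hf⟩ := H.exists_third (hg c) (hg d) h2
    have hfi : G.Inc f v := (hf.2.2.2 f).2 (.inr (.inr rfl))
    have hall : ∀ j, j = c ∨ j = d ∨ j = e := by omega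
    refine ⟨f, g c, g d, c, H.edgesAt hfi (hg c) (hg d) hf.2.1.symm hf.2.2.1.symm h2, ?_, ?_, ?_⟩
    · refine Finset.eq_empty_of_forall_notMem fun j hj ↦ ?_
      rw [hiff f hfi] at hj
      rcases hall j with rfl | rfl | rfl
      exacts [hf.2.1 hj, hf.2.2.1 hj, hf.2.2.1 (h1.trans hj)]
    · ext j
      rw [hiff _ (hg c), Finset.mem_singleton]
      rcases hall j with rfl | rfl | rfl
      · simp
      · simp [h2.symm, hcd.symm]
      · simp [← h1, h2.symm, hec]
    · ext j
      rw [hiff _ (hg d), Finset.mem_compl, Finset.mem_singleton]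
      rcases hall j with rfl | rfl | rfl
      · simp [h2]
      · simp [hcd.symm]
      · simp [h1, hec]
  by_cases h01 : g 0 = g 1
  · by_cases h02 : g 0 = g 2
    · left
      obtain ⟨f, hfi, hf⟩ : ∃ f, G.Inc f v ∧ f ≠ g 0 := by
        by_contra! hcon
        have : G.incidenceSet v ⊆ {g 0} := fun e he ↦ hcon e he
        have := Set.ncard_le_ncard this
        rw [H.ncard_incidenceSet v hv, Set.ncard_singleton] at this
        omega
      obtain ⟨f', hf'⟩ := H.exists_third hfi (hg 0) hf
      have hfi' := (hf'.2.2.2 f').2 (.inr (.inr rfl))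
      have hall : ∀ j, g j = g 0 := by
        intro j
        fin_cases j
        exacts [rfl, h01.symm, h02.symm]
      refine ⟨f, f', g 0, H.edgesAt hfi hfi' (hg 0) hf'.2.1 hf'.1 hf'.2.2.1.symm, ?_, ?_, ?_⟩
      · refine Finset.eq_empty_of_forall_notMem fun j hj ↦ ?_
        rw [hiff f hfi, hall] at hj
        exact hf hj.symm
      · refine Finset.eq_empty_of_forall_notMem fun j hj ↦ ?_
        rw [hiff f' hfi', hall] at hj
        exact hf'.2.2.1 hj
      · ext j
        simp [hiff _ (hg 0), hall]
    · exact .inr (.inl (hfew 2 0 1 (by decide) (by decide) (by decide) h01 (Ne.symm h02)))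
  · by_cases h02 : g 0 = g 2
    · exact .inr (.inl (hfew 1 0 2 (by decide) (by decide) (by decide) h02 (Ne.symm h01)))
    by_cases h12 : g 1 = g 2
    · exact .inr (.inl (hfew 0 1 2 (by decide) (by decide) (by decide) h12 h01))
    refine .inr (.inr ⟨g 0, g 1, g 2, H.edgesAt (hg 0) (hg 1) (hg 2) h01 h02 h12, ?_, ?_, ?_⟩) <;>
      ext j <;> rw [hiff _ (hg _), Finset.mem_singleton] <;> fin_cases j <;>
      simp [h01, h02, h12, Ne.symm h01, Ne.symm h02, Ne.symm h12]

end IsFactorTriple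

/-- The edges in none of the `M i`, together with one of their ends. -/
abbrev Dart (G : Graph α β) (M : Fin 3 → Set β) : Type _ :=
  {p : α × β // G.Inc p.2 p.1 ∧ indices M p.2 = ∅}

/-- The edges in all of the `M i`. -/
abbrev TripleEdge (G : Graph α β) (M : Fin 3 → Set β) : Type _ :=
  {e : β // e ∈ E(G) ∧ indices M e = Finset.univ}

/-- `d'` is the other dart at the item of `d`, which has the given label. -/
def Opposite (d d' : Dart G M) : TripleEdge G M ⊕ ℕ → Prop
  | .inl e => d'.1.1 = d.1.1 ∧ d'.1.2 ≠ d.1.2 ∧ G.Inc e.1 d.1.1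
  | .inr k => ∃ c : Fin 3, k = c ∧ ∃ h, G.IsLink h d.1.1 d'.1.1 ∧ indices M h = {c}ᶜ

theorem Opposite.symm {d d' : Dart G M} {l : TripleEdge G M ⊕ ℕ} (h : Opposite d d' l) :
    Opposite d' d l := by
  rcases l with e | k
  · exact ⟨h.1.symm, h.2.1.symm, by rw [h.1]; exact h.2.2⟩
  · obtain ⟨c, hc, h', hl, hi⟩ := h
    exact ⟨c, hc, h', hl.symm, hi⟩

namespace IsFactorTriple

variable (H : G.IsFactorTriple M)

include H

theorem edgesAt_of_opposite {d d' : Dart G M} {e : TripleEdge G M} (h : Opposite d d' (.inl e)) :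
    G.EdgesAt d.1.1 d.1.2 d'.1.2 e.1 := by
  have hne : ∀ d : Dart G M, d.1.2 ≠ e.1 := by
    intro d hd
    have := d.2.2
    rw [hd, e.2.2] at this
    exact absurd this (by decide)
  exact H.edgesAt d.2.1 (by rw [← h.1]; exact d'.2.1) h.2.2 h.2.1.symm (hne d) (hne d')

/-- The type of the vertex decides the kind of item. A vertex item has exactly two E₀ edges, and
each end of an E₂ edge has exactly one. -/
theorem opposite_unique {d d₁ d₂ : Dart G M} {l₁ l₂ : TripleEdge G M ⊕ ℕ}
    (h₁ : Opposite d d₁ l₁) (h₂ : Opposite d d₂ l₂) : d₁ = d₂ ∧ l₁ = l₂ := by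
  have hmix : ∀ {d₁ d₂ : Dart G M} {e : TripleEdge G M} {k : ℕ}, Opposite d d₁ (.inl e) →
      ¬ Opposite d d₂ (.inr k) := by
    rintro d₁ d₂ e k h₁ ⟨c, -, h, hl, hh⟩
    have h1 := d.2.2
    have h2 := d₁.2.2
    have h3 := e.2.2
    rcases ((H.edgesAt_of_opposite h₁).2.2.2 h).1 hl.inc_left with rfl | rfl | rfl
    · rw [h1] at hh
      exact empty_ne_compl_singleton _ hh
    · rw [h2] at hh
      exact empty_ne_compl_singleton _ hh
    · rw [h3] at hh
      exact univ_ne_compl_singleton _ hh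
  rcases l₁ with e₁ | k₁ <;> rcases l₂ with e₂ | k₂
  · have k₁ := H.edgesAt_of_opposite h₁
    have k₂ := H.edgesAt_of_opposite h₂
    have hd₁ := d₁.2.2
    have hd₂ := d₂.2.2
    have he₂ := e₂.2.2
    have hd := d.2.2
    have hed : d₂.1.2 = d₁.1.2 := by
      rcases (k₁.2.2.2 _).1 ((k₂.2.2.2 _).2 (.inr (.inl rfl))) with h | h | h
      · exact absurd h h₂.2.1
      · exact h
      · rw [h, e₁.2.2] at hd₂
        exact absurd hd₂ (by decide)
    have hee : e₂.1 = e₁.1 := by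
      rcases (k₁.2.2.2 _).1 ((k₂.2.2.2 _).2 (.inr (.inr rfl))) with h | h | h
      · rw [h, hd] at he₂
        exact absurd he₂ (by decide)
      · rw [h, hd₁] at he₂
        exact absurd he₂ (by decide)
      · exact h
    refine ⟨Subtype.ext (Prod.ext (h₁.1.trans h₂.1.symm) hed.symm), ?_⟩
    rw [Subtype.ext hee]
  · exact absurd h₂ (hmix h₁)
  · exact absurd h₁ (hmix h₂)
  · obtain ⟨c₁, rfl, g₁, hl₁, hg₁⟩ := h₁
    obtain ⟨c₂, rfl, g₂, hl₂, hg₂⟩ := h₂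
    obtain ⟨p, hp, hpc⟩ := H.exists_pendent d.2.1 hl₁.inc_left d.2.2 hg₁
    have hd := d.2.2
    have hgg : g₂ = g₁ := by
      rcases (hp.2.2.2 _).1 hl₂.inc_left with rfl | rfl | rfl
      · rw [hd] at hg₂
        exact absurd hg₂ (empty_ne_compl_singleton _)
      · rw [hpc] at hg₂
        exact absurd hg₂ (singleton_ne_compl_singleton _ _)
      · rfl
    subst hgg
    have hcc : c₁ = c₂ := by
      rw [hg₁] at hg₂
      simpa using hg₂
    have hv := hl₁.right_unique hl₂
    obtain ⟨p', hp', hpc'⟩ := H.exists_pendent d₁.2.1 hl₁.inc_right d₁.2.2 hg₁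
    have hd₂ := d₂.2.2
    refine ⟨Subtype.ext (Prod.ext hv ?_), by rw [hcc]⟩
    rcases (hp'.2.2.2 d₂.1.2).1 (by rw [hv]; exact d₂.2.1) with h | h | h
    · exact h.symm
    · rw [h, hpc'] at hd₂
      exact absurd hd₂ (Finset.singleton_ne_empty _)
    · rw [h, hg₁] at hd₂
      exact absurd hd₂.symm (empty_ne_compl_singleton _)

theorem exists_dart {h : β} {v : α} {c : Fin 3} (hv : G.Inc h v) (hh : indices M h = {c}ᶜ) :
    ∃ d : Dart G M, d.1.1 = v := by
  rcases H.vertex_cases hv.vertex_mem with ⟨f, _, _, hf, hf', -⟩ | ⟨f, _, _, _, hf, hf', -⟩ |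
    ⟨a, b, c, ha, h0, h1, h2⟩
  · exact ⟨⟨(v, f), (hf.2.2.2 f).2 (.inl rfl), hf'⟩, rfl⟩
  · exact ⟨⟨(v, f), (hf.2.2.2 f).2 (.inl rfl), hf'⟩, rfl⟩
  · exfalso
    rcases (ha.2.2.2 h).1 hv with rfl | rfl | rfl
    · rw [h0] at hh
      exact singleton_ne_compl_singleton _ _ hh
    · rw [h1] at hh
      exact singleton_ne_compl_singleton _ _ hh
    · rw [h2] at hh
      exact singleton_ne_compl_singleton _ _ hh

theorem exists_opposite_of_isLink {d : Dart G M} {h : β} {w : α} {c : Fin 3}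
    (hl : G.IsLink h d.1.1 w) (hh : indices M h = {c}ᶜ) :
    ∃ d', d'.1.1 = w ∧ Opposite d d' (.inr c) := by
  obtain ⟨d', rfl⟩ := H.exists_dart hl.inc_right hh
  exact ⟨d', rfl, c, rfl, h, hl, hh⟩

theorem exists_opposite (d : Dart G M) : ∃ d' l, Opposite d d' l := by
  have hd := d.2.2
  rcases H.vertex_cases d.2.1.vertex_mem with ⟨f, f', e, hf, hfi, hfi', he⟩ |
    ⟨f, p, h, c, hf, hfi, hp, hh⟩ | ⟨a, b, c, ha, h0, h1, h2⟩
  · have hfv := (hf.2.2.2 f).2 (.inl rfl)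
    have hfv' := (hf.2.2.2 f').2 (.inr (.inl rfl))
    have hev := (hf.2.2.2 e).2 (.inr (.inr rfl))
    rcases (hf.2.2.2 d.1.2).1 d.2.1 with h | h | h
    · exact ⟨⟨(d.1.1, f'), hfv', hfi'⟩, .inl ⟨e, hev.edge_mem, he⟩, rfl, by rw [h]; exact hf.1.symm,
        hev⟩
    · exact ⟨⟨(d.1.1, f), hfv, hfi⟩, .inl ⟨e, hev.edge_mem, he⟩, rfl, by rw [h]; exact hf.1, hev⟩
    · rw [h, he] at hd
      exact absurd hd (by decide)
  · obtain ⟨w, hw⟩ := (hf.2.2.2 h).2 (.inr (.inr rfl))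
    obtain ⟨d', -, h'⟩ := H.exists_opposite_of_isLink hw hh
    exact ⟨d', _, h'⟩
  · rcases (ha.2.2.2 d.1.2).1 d.2.1 with h | h | h <;> rw [h] at hd <;> simp_all

theorem exists_dart_of_tripleEdge (e : TripleEdge G M) {v : α} (hv : G.Inc e.1 v) :
    ∃ d d' : Dart G M, d.1.1 = v ∧ Opposite d d' (.inl e) := by
  have he := e.2.2
  rcases H.vertex_cases hv.vertex_mem with ⟨f, f', e', hf, hfi, hfi', he'⟩ |
    ⟨f, p, h, c, hf, hfi, hp, hh⟩ | ⟨a, b, c, ha, h0, h1, h2⟩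
  · have hfv := (hf.2.2.2 f).2 (.inl rfl)
    have hfv' := (hf.2.2.2 f').2 (.inr (.inl rfl))
    exact ⟨⟨(v, f), hfv, hfi⟩, ⟨(v, f'), hfv', hfi'⟩, rfl, rfl, hf.1.symm, hv⟩
  · exfalso
    rcases (hf.2.2.2 e.1).1 hv with h' | h' | h'
    · rw [h', hfi] at he
      exact absurd he (by decide)
    · rw [h', hp] at he
      exact singleton_ne_univ _ he
    · rw [h', hh] at he
      exact univ_ne_compl_singleton _ he.symm
  · exfalso
    rcases (ha.2.2.2 e.1).1 hv with h' | h' | h' <;> rw [h'] at he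
    · exact absurd (h0.symm.trans he) (by decide)
    · exact absurd (h1.symm.trans he) (by decide)
    · exact absurd (h2.symm.trans he) (by decide)

omit H in
theorem _root_.Graph.Dart.other_mem (d : Dart G M) :
    G.Inc d.1.2 d.2.1.other ∧ indices M d.1.2 = ∅ := ⟨d.2.1.inc_other, d.2.2⟩

omit H in
/-- The dart at the other end of the same edge. -/
noncomputable def _root_.Graph.Dart.flip (d : Dart G M) : Dart G M :=
  ⟨(d.2.1.other, d.1.2), d.other_mem⟩

omit H in
theorem _root_.Graph.Dart.isLink_flip (d : Dart G M) : G.IsLink d.1.2 d.1.1 d.flip.1.1 :=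
  d.2.1.isLink_other

theorem exists_coreDarts : ∃ A : CoreDarts (Dart G M) (TripleEdge G M),
    A.τ = Dart.flip ∧ ∀ d, Opposite d (A.σ d) (A.label d) := by
  choose σ label hσ using H.exists_opposite
  have hσσ : ∀ d, σ (σ d) = d ∧ label (σ d) = label d := fun d ↦
    H.opposite_unique (hσ (σ d)) (hσ d).symm
  refine ⟨⟨σ, Dart.flip, fun d ↦ (hσσ d).1, ?_, ?_, ?_, label, fun d ↦ (hσσ d).2, ?_, ?_, ?_⟩,
    rfl, hσ⟩
  · intro d
    exact Subtype.ext (Prod.ext (d.flip.isLink_flip.right_unique d.isLink_flip.symm) rfl)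
  · intro d hd
    have h := hσ d
    rcases hl : label d with e | k <;> rw [hl, hd] at h
    · exact h.2.1 rfl
    · obtain ⟨c, -, g, hg, -⟩ := h
      exact H.not_isLoopAt _ _ hg
  · intro d hd
    have := d.isLink_flip
    rw [hd] at this
    exact H.not_isLoopAt _ _ this
  · intro d c hd
    have h := hσ d
    rw [hd] at h
    obtain ⟨i, rfl, -⟩ := h
    exact i.2
  · intro d e hd h'
    have h := hσ d
    rw [hd, ← h'] at h
    have h2 := d.isLink_flip
    rw [h.1] at h2
    exact H.not_isLoopAt _ _ h2
  · intro e
    obtain ⟨x, y, hxy⟩ := G.exists_isLink_of_mem_edgeSet e.2.1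
    obtain ⟨d₁, d₁', rfl, h₁⟩ := H.exists_dart_of_tripleEdge e hxy.inc_left
    obtain ⟨d₂, d₂', rfl, h₂⟩ := H.exists_dart_of_tripleEdge e hxy.inc_right
    refine ⟨d₁, d₂, fun d hd ↦ ?_⟩
    have h := hσ d
    rw [hd] at h
    have key : ∀ d₀ d₀' : Dart G M, Opposite d₀ d₀' (.inl e) → d.1.1 = d₀.1.1 →
        d = d₀ ∨ d = σ d₀ := by
      intro d₀ d₀' h₀ hv
      have hinc := d.2.1
      rw [hv] at hinc
      obtain ⟨rfl, -⟩ := H.opposite_unique h₀ (hσ d₀)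
      rcases ((H.edgesAt_of_opposite h₀).2.2.2 _).1 hinc with h' | h' | h'
      · exact .inl (Subtype.ext (Prod.ext hv h'))
      · exact .inr (Subtype.ext (Prod.ext (hv.trans h₀.1.symm) h'))
      · have := d.2.2
        rw [h', e.2.2] at this
        exact absurd this (by decide)
    rcases h.2.2.eq_or_eq_of_isLink hxy with hv | hv
    · exact (key _ _ h₁ hv).imp_right .inl
    · exact .inr (.inr (key _ _ h₂ hv))

end IsFactorTriple

end Graph

namespace CoreItem

theorem midColor_spec : ∀ (c : Fin 3) (a b : Fin 5), a.1 ≠ c ∧ b.1 ≠ c →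
    midColor c a b < 5 ∧ midColor c a b ≠ c := by decide +kernel

theorem valid_vertex {e x a b : ℕ} (h : (vertex e x).valid a b = true) :
    a ≠ b ∧ a ≠ e ∧ b ≠ e ∧ a < 5 ∧ b < 5 := by
  simpa [valid, and_assoc] using h

theorem valid_edge {c a b : ℕ} (hc : c < 3) (h : (edge c).valid a b = true) :
    a ≠ c ∧ midColor c a b ≠ a ∧ midColor c a b ≠ c ∧ midColor c a b < 5 ∧ a < 5 := by
  simp [valid, and_assoc] at h
  obtain ⟨h1, h2, h3, h4, h5, h6⟩ := h
  have := midColor_spec ⟨c, hc⟩ ⟨a, h5⟩ ⟨b, h6⟩ ⟨h1, h2⟩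
  exact ⟨h1, h3, this.2, this.1, h5⟩

theorem clash_eq_zero {R S : ℕ} (h : clash R S = 0) : R = S ∨ R &&& S = 0 := by
  unfold clash at h
  by_cases h1 : R = 127
  · simp [h1] at h
  · rw [beq_eq_false_iff_ne.2 h1] at h
    by_contra! h2
    have : (R == S || R &&& S == 0) = false := by simp [h2.1, h2.2]
    rw [this] at h
    simp at h

end CoreItem

/-! ### From colorings of darts to proper edge colorings. -/

namespace Graph

variable {α β : Type*} {G : Graph α β} {M : Fin 3 → Set β}

/-- The other two edges at the end `v` of `e` have the color set `m`, given as a bit mask. -/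
def SeesMask (G : Graph α β) (ψ : β → Fin 5) (v : α) (e : β) (m : ℕ) : Prop :=
  ∃ a b, G.EdgesAt v e a b ∧ m = 2 ^ (ψ a : ℕ) + 2 ^ (ψ b : ℕ)

theorem EdgesAt.perm₁ {v : α} {a b c : β} (h : G.EdgesAt v a b c) : G.EdgesAt v b a c :=
  ⟨h.1.symm, h.2.2.1, h.2.1, fun e ↦ by rw [h.2.2.2 e]; tauto⟩

theorem EdgesAt.perm₂ {v : α} {a b c : β} (h : G.EdgesAt v a b c) : G.EdgesAt v a c b :=
  ⟨h.2.1, h.1, h.2.2.1.symm, fun e ↦ by rw [h.2.2.2 e]; tauto⟩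

theorem EdgesAt.inc₁ {v : α} {a b c : β} (h : G.EdgesAt v a b c) : G.Inc a v :=
  (h.2.2.2 a).2 (.inl rfl)

theorem EdgesAt.inc₂ {v : α} {a b c : β} (h : G.EdgesAt v a b c) : G.Inc b v := h.perm₁.inc₁

theorem EdgesAt.inc₃ {v : α} {a b c : β} (h : G.EdgesAt v a b c) : G.Inc c v := h.perm₂.inc₂

/-- Equal masks give three colors in total, disjoint masks give five. -/
theorem card_colors : ∀ e a b c d : Fin 5, a ≠ b ∧ e ≠ a ∧ e ≠ b ∧ c ≠ d ∧ e ≠ c ∧ e ≠ d ∧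
    (2 ^ (a : ℕ) + 2 ^ (b : ℕ) = 2 ^ (c : ℕ) + 2 ^ (d : ℕ) ∨
      (2 ^ (a : ℕ) + 2 ^ (b : ℕ)) &&& (2 ^ (c : ℕ) + 2 ^ (d : ℕ)) = 0) →
    ({e, a, b, c, d} : Finset (Fin 5)).card = 3 ∨ ({e, a, b, c, d} : Finset (Fin 5)).card = 5 := by
  decide +kernel

theorem isNormalEdge_of_seesMask {ψ : β → Fin 5} (hψ : G.IsProperEdgeColoring ψ) {e : β} {u v : α}
    (h : G.IsLink e u v) {m n : ℕ} (hm : G.SeesMask ψ u e m) (hn : G.SeesMask ψ v e n)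
    (hmn : m = n ∨ m &&& n = 0) : G.IsNormalEdge ψ e := by
  obtain ⟨a, b, hab, rfl⟩ := hm
  obtain ⟨c, d, hcd, rfl⟩ := hn
  have heq : G.colorsAround ψ e = (({ψ e, ψ a, ψ b, ψ c, ψ d} : Finset (Fin 5)) : Set (Fin 5)) := by
    have : {f | ∃ x, G.Inc e x ∧ G.Inc f x} = {e, a, b, c, d} := by
      ext f
      simp only [Set.mem_ofPred_eq, Set.mem_insert_iff, Set.mem_singleton_iff]
      constructor
      · rintro ⟨x, hx, hf⟩
        rcases hx.eq_or_eq_of_isLink h with rfl | rfl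
        · rw [hab.2.2.2] at hf
          tauto
        · rw [hcd.2.2.2] at hf
          tauto
      · intro hf
        have h1 := (hab.2.2.2 f).2
        have h2 := (hcd.2.2.2 f).2
        rcases hf with hf | hf | hf | hf | hf
        · exact ⟨u, h.inc_left, h1 (by tauto)⟩
        · exact ⟨u, h.inc_left, h1 (by tauto)⟩
        · exact ⟨u, h.inc_left, h1 (by tauto)⟩
        · exact ⟨v, h.inc_right, h2 (by tauto)⟩
        · exact ⟨v, h.inc_right, h2 (by tauto)⟩
    rw [colorsAround, this]
    simp [Set.image_insert_eq]
  unfold IsNormalEdge IsPoor IsRich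
  rw [heq, Set.ncard_coe_finset]
  exact card_colors _ _ _ _ _ ⟨hψ hab.inc₂ hab.inc₃ hab.2.2.1, hψ hab.inc₁ hab.inc₂ hab.1,
    hψ hab.inc₁ hab.inc₃ hab.2.1, hψ hcd.inc₂ hcd.inc₃ hcd.2.2.1, hψ hcd.inc₁ hcd.inc₂ hcd.1,
    hψ hcd.inc₁ hcd.inc₃ hcd.2.1, hmn⟩

/-- A coloring of the darts which respects the items. -/
structure IsDartColoring (A : CoreDarts (Dart G M) (TripleEdge G M)) (N : Set (TripleEdge G M))
    (x : TripleEdge G M → ℕ) (φ : Dart G M → ℕ) : Prop where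
  τ_eq : A.τ = Dart.flip
  opposite : ∀ d, Opposite d (A.σ d) (A.label d)
  target_lt : ∀ e, x e < 3
  flip : ∀ d : Dart G M, φ d.flip = φ d
  valid : ∀ d, (A.item N x d).valid (φ d) (φ (A.σ d)) = true

open Classical in
/-- `ψ` is the coloring of the edges of `G` which belongs to a coloring of the darts. -/
structure IsExtension (A : CoreDarts (Dart G M) (TripleEdge G M)) (N : Set (TripleEdge G M))
    (φ : Dart G M → ℕ) (ψ : β → Fin 5) : Prop where
  dart : ∀ d : Dart G M, (ψ d.1.2 : ℕ) = φ d
  triple : ∀ e : TripleEdge G M, (ψ e.1 : ℕ) = if e ∈ N then 4 else 3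
  single : ∀ e i, indices M e = {i} → (ψ e : ℕ) = i
  double : ∀ (d : Dart G M) (c : Fin 3) (h : β), G.IsLink h d.1.1 (A.σ d).1.1 →
    indices M h = {c}ᶜ → (ψ h : ℕ) = CoreItem.midColor c (φ d) (φ (A.σ d))

namespace IsFactorTriple

open CoreItem

variable (H : G.IsFactorTriple M)
include H

theorem eq_of_indices_eq_compl {v : α} {c : Fin 3} {h h' : β} (hh : G.Inc h v) (hh' : G.Inc h' v)
    (hc : indices M h = {c}ᶜ) (hc' : indices M h' = {c}ᶜ) : h = h' := by
  obtain ⟨j, hj⟩ := exists_ne c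
  exact H.eq_of_mem (i := j) hh hh' (by simpa [hc]) (by simpa [hc'])

theorem eq_of_indices_eq_singleton {v : α} {c : Fin 3} {h h' : β} (hh : G.Inc h v)
    (hh' : G.Inc h' v) (hc : indices M h = {c}) (hc' : indices M h' = {c}) : h = h' :=
  H.eq_of_mem (i := c) hh hh' (by simp [hc]) (by simp [hc'])

theorem dart_eq {d d' : Dart G M} {h : β} {c : Fin 3} (hh : G.Inc h d.1.1) (hc : indices M h = {c}ᶜ)
    (hv : d'.1.1 = d.1.1) : d' = d := by
  obtain ⟨p, hp, hpc⟩ := H.exists_pendent d.2.1 hh d.2.2 hc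
  have hd' := d'.2.2
  refine Subtype.ext (Prod.ext hv ?_)
  rcases (hp.2.2.2 d'.1.2).1 (by rw [← hv]; exact d'.2.1) with h1 | h1 | h1
  · exact h1
  · rw [h1, hpc] at hd'
    exact absurd hd' (Finset.singleton_ne_empty _)
  · rw [h1, hc] at hd'
    exact absurd hd'.symm (empty_ne_compl_singleton _)

omit H in
theorem _root_.Graph.Dart.eq_or_eq_flip {d d' : Dart G M} (h : d'.1.2 = d.1.2) :
    d' = d ∨ d' = d.flip := by
  have hinc := d'.2.1
  rw [h] at hinc
  rcases hinc.eq_or_eq_of_isLink d.isLink_flip with hv | hv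
  · exact .inl (Subtype.ext (Prod.ext hv h))
  · exact .inr (Subtype.ext (Prod.ext hv h))

theorem exists_dart_or {v : α} (hv : v ∈ V(G)) : (∃ d : Dart G M, d.1.1 = v) ∨
    ∃ a₀ a₁ a₂, G.EdgesAt v a₀ a₁ a₂ ∧ indices M a₀ = {0} ∧ indices M a₁ = {1} ∧
      indices M a₂ = {2} := by
  rcases H.vertex_cases hv with ⟨f, _, _, hf, hf', -⟩ | ⟨f, _, _, _, hf, hf', -⟩ | h
  · exact .inl ⟨⟨(v, f), hf.inc₁, hf'⟩, rfl⟩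
  · exact .inl ⟨⟨(v, f), hf.inc₁, hf'⟩, rfl⟩
  · exact .inr h

end IsFactorTriple

namespace IsDartColoring

open CoreItem

variable {A : CoreDarts (Dart G M) (TripleEdge G M)} {N : Set (TripleEdge G M)}
  {x : TripleEdge G M → ℕ} {φ : Dart G M → ℕ} {ψ : β → Fin 5}

theorem edgesAt_inl (hφ : IsDartColoring A N x φ) (H : G.IsFactorTriple M) {d : Dart G M}
    {e : TripleEdge G M} (h : A.label d = .inl e) :
    G.EdgesAt d.1.1 d.1.2 (A.σ d).1.2 e.1 :=
  H.edgesAt_of_opposite (by rw [← h]; exact hφ.opposite d)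

theorem edgesAt_inr (hφ : IsDartColoring A N x φ) (H : G.IsFactorTriple M) {d : Dart G M}
    {k : ℕ} (h : A.label d = .inr k) :
    ∃ (c : Fin 3) (p g : β), k = c ∧ G.EdgesAt d.1.1 d.1.2 p g ∧ indices M p = {c} ∧
      indices M g = {c}ᶜ ∧ G.IsLink g d.1.1 (A.σ d).1.1 := by
  have h1 := hφ.opposite d
  rw [h] at h1
  obtain ⟨c, hc, g, hl, hg⟩ := h1
  obtain ⟨p, hp, hpc⟩ := H.exists_pendent d.2.1 hl.inc_left d.2.2 hg
  exact ⟨c, p, g, hc, hp, hpc, hg, hl⟩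

theorem lt_five (hφ : IsDartColoring A N x φ) (d : Dart G M) : φ d < 5 := by
  have := hφ.valid d
  rcases h : A.label d with e | c
  · classical
    rw [A.item_inl h] at this
    exact (valid_vertex this).2.2.2.1
  · rw [A.item_inr h] at this
    exact (valid_edge (A.label_lt _ _ h) this).2.2.2.2

/-- The prescriptions concern disjoint classes of edges. Consistency needs the same color at both
darts of an E₀ edge and the symmetry of `midColor` for an E₂ edge seen from its two ends. -/
theorem exists_isExtension (hφ : IsDartColoring A N x φ) (H : G.IsFactorTriple M) :
    ∃ ψ, IsExtension A N φ ψ := by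
  classical
  have key : ∀ g, ∃ k : Fin 5, (∀ d : Dart G M, d.1.2 = g → (k : ℕ) = φ d) ∧
      (∀ e : TripleEdge G M, e.1 = g → (k : ℕ) = if e ∈ N then 4 else 3) ∧
      (∀ i, indices M g = {i} → (k : ℕ) = i) ∧
      ∀ (d : Dart G M) (c : Fin 3), G.IsLink g d.1.1 (A.σ d).1.1 →
        indices M g = {c}ᶜ → (k : ℕ) = CoreItem.midColor c (φ d) (φ (A.σ d)) := by
    intro g
    by_cases h1 : ∃ d : Dart G M, d.1.2 = g
    · obtain ⟨d, rfl⟩ := h1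
      have hd := d.2.2
      refine ⟨⟨φ d, hφ.lt_five d⟩, fun d' h ↦ ?_, fun e h ↦ ?_, fun i h ↦ ?_, fun d' c _ h ↦ ?_⟩
      · rcases d.eq_or_eq_flip h with rfl | rfl
        exacts [rfl, (hφ.flip d).symm]
      · rw [← h, e.2.2] at hd
        exact absurd hd (by decide)
      · exact absurd (h.symm.trans hd) (Finset.singleton_ne_empty _)
      · exact absurd (hd.symm.trans h) (empty_ne_compl_singleton _)
    by_cases h2 : ∃ e : TripleEdge G M, e.1 = g
    · obtain ⟨e, rfl⟩ := h2
      have he := e.2.2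
      refine ⟨if e ∈ N then 4 else 3, fun d h ↦ absurd ⟨d, h⟩ h1, fun e' h ↦ ?_, fun i h ↦ ?_,
        fun d' c _ h ↦ ?_⟩
      · rw [Subtype.ext h]
        split_ifs <;> rfl
      · exact absurd (h.symm.trans he) (singleton_ne_univ _)
      · exact absurd (he.symm.trans h) (univ_ne_compl_singleton _)
    by_cases h3 : ∃ i, indices M g = {i}
    · obtain ⟨i, hi⟩ := h3
      refine ⟨⟨i, by omega⟩, fun d h ↦ absurd ⟨d, h⟩ h1, fun e h ↦ absurd ⟨e, h⟩ h2,
        fun j h ↦ ?_, fun d' c _ h ↦ ?_⟩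
      · rw [hi, Finset.singleton_inj] at h
        rw [h]
      · exact absurd (hi.symm.trans h) (singleton_ne_compl_singleton _ _)
    by_cases h4 : ∃ (d : Dart G M) (c : Fin 3), G.IsLink g d.1.1 (A.σ d).1.1 ∧ indices M g = {c}ᶜ
    · obtain ⟨d, c, hl, hc⟩ := h4
      have hlab : A.label d = .inr (c : ℕ) :=
        (H.opposite_unique (hφ.opposite d) (l₂ := .inr (c : ℕ)) (d₂ := A.σ d) ⟨c, rfl, g, hl, hc⟩).2
      have hval := hφ.valid d
      rw [A.item_inr hlab] at hval
      refine ⟨⟨midColor c (φ d) (φ (A.σ d)), (valid_edge c.2 hval).2.2.2.1⟩,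
        fun d h ↦ absurd ⟨d, h⟩ h1, fun e h ↦ absurd ⟨e, h⟩ h2, fun j h ↦ absurd ⟨j, h⟩ h3,
        fun d' c' hl' hc' ↦ ?_⟩
      obtain rfl : c = c' := by
        rw [hc] at hc'
        simpa using hc'
      rcases hl'.inc_left.eq_or_eq_of_isLink hl with hv | hv
      · rw [H.dart_eq hl.inc_left hc hv]
      · rw [H.dart_eq hl.inc_right hc hv, A.σ_invol]
        exact midColor_comm _ _ _
    · exact ⟨0, fun d h ↦ absurd ⟨d, h⟩ h1, fun e h ↦ absurd ⟨e, h⟩ h2, fun j h ↦ absurd ⟨j, h⟩ h3,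
        fun d c h h' ↦ absurd ⟨d, c, h, h'⟩ h4⟩
  choose ψ h₁ h₂ h₃ h₄ using key
  exact ⟨ψ, fun d ↦ h₁ _ d rfl, fun e ↦ h₂ _ e rfl, h₃, fun d c h ↦ h₄ h d c⟩

theorem isProperEdgeColoring (hφ : IsDartColoring A N x φ) (H : G.IsFactorTriple M)
    (hψ : IsExtension A N φ ψ) : G.IsProperEdgeColoring ψ := by
  classical
  have key : ∀ v ∈ V(G), ∃ a b c, G.EdgesAt v a b c ∧ (ψ a : ℕ) ≠ ψ b ∧ (ψ a : ℕ) ≠ ψ c ∧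
      (ψ b : ℕ) ≠ ψ c := by
    intro v hv
    rcases H.exists_dart_or hv with ⟨d, rfl⟩ | ⟨a, b, c, habc, ha, hb, hc⟩
    · have hval := hφ.valid d
      rcases hl : A.label d with e | k
      · refine ⟨_, _, _, hφ.edgesAt_inl H hl, ?_⟩
        rw [A.item_inl hl] at hval
        rw [hψ.dart, hψ.dart, hψ.triple]
        have := valid_vertex hval
        exact ⟨this.1, this.2.1, this.2.2.1⟩
      · obtain ⟨c, p, g, rfl, hE, hp, hg, hlink⟩ := hφ.edgesAt_inr H hl
        refine ⟨_, _, _, hE, ?_⟩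
        rw [A.item_inr hl] at hval
        rw [hψ.dart, hψ.single _ _ hp, hψ.double _ _ _ hlink hg]
        have := valid_edge c.2 hval
        exact ⟨this.1, this.2.1.symm, this.2.2.1.symm⟩
    · refine ⟨a, b, c, habc, ?_⟩
      rw [hψ.single _ _ ha, hψ.single _ _ hb, hψ.single _ _ hc]
      decide
  intro e f v he hf hef
  obtain ⟨a, b, c, hE, h1, h2, h3⟩ := key v he.vertex_mem
  rw [hE.2.2.2] at he hf
  intro h
  rcases he with rfl | rfl | rfl <;> rcases hf with rfl | rfl | rfl <;> simp_all

theorem seesMask_dart (hφ : IsDartColoring A N x φ) (H : G.IsFactorTriple M)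
    (hψ : IsExtension A N φ ψ) (d : Dart G M) :
    G.SeesMask ψ d.1.1 d.1.2 ((A.item N x d).others (φ d) (φ (A.σ d))) := by
  classical
  rcases hl : A.label d with e | k
  · refine ⟨_, _, hφ.edgesAt_inl H hl, ?_⟩
    rw [A.item_inl hl, hψ.dart, hψ.triple]
    rfl
  · obtain ⟨c, p, g, rfl, hE, hp, hg, hlink⟩ := hφ.edgesAt_inr H hl
    refine ⟨_, _, hE.perm₂, ?_⟩
    rw [A.item_inr hl, hψ.single _ _ hp, hψ.double _ _ _ hlink hg]
    rfl

theorem seesMask_triple (hφ : IsDartColoring A N x φ) (H : G.IsFactorTriple M)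
    (hψ : IsExtension A N φ ψ) {d : Dart G M} {e : TripleEdge G M} (hl : A.label d = .inl e) :
    G.SeesMask ψ d.1.1 e.1 (2 ^ φ d + 2 ^ φ (A.σ d)) := by
  refine ⟨_, _, (hφ.edgesAt_inl H hl).perm₂.perm₁, ?_⟩
  rw [hψ.dart, hψ.dart]

theorem _root_.Graph.IsExtension.seesMask_double (hψ : IsExtension A N φ ψ) (H : G.IsFactorTriple M)
    {d : Dart G M} {h : β} {c : Fin 3} (hh : G.Inc h d.1.1)
    (hc : indices M h = {c}ᶜ) : G.SeesMask ψ d.1.1 h (2 ^ φ d + 2 ^ (c : ℕ)) := by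
  obtain ⟨p, hp, hpc⟩ := H.exists_pendent d.2.1 hh d.2.2 hc
  refine ⟨_, _, hp.perm₂.perm₁, ?_⟩
  rw [hψ.dart, hψ.single _ _ hpc]

/-- At an end of `p`, the other edges have the colors `3, 4` or those of `0, 1, 2` other than that
of `p`, unless `p` is charged there. -/
theorem seesMask_single (hφ : IsDartColoring A N x φ) (H : G.IsFactorTriple M)
    (hψ : IsExtension A N φ ψ) {p : β} {v : α} {c : Fin 3} (hp : G.Inc p v)
    (hc : indices M p = {c}) : G.SeesMask ψ v p (7 - 2 ^ (c : ℕ)) ∨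
      ∃ d : Dart G M, d.1.1 = v ∧ A.label d = .inr (c : ℕ) ∧
        G.SeesMask ψ v p (2 ^ φ d + 2 ^ midColor c (φ d) (φ (A.σ d))) := by
  rcases H.exists_dart_or hp.vertex_mem with ⟨d, rfl⟩ | ⟨a₀, a₁, a₂, hE, h₀, h₁, h₂⟩
  · have hd := d.2.2
    right
    refine ⟨d, rfl, ?_⟩
    rcases hl : A.label d with e | k
    · exfalso
      have hd' := (A.σ d).2.2
      have he := e.2.2
      rcases ((hφ.edgesAt_inl H hl).2.2.2 p).1 hp with h | h | h
      · rw [h, hd] at hc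
        exact Finset.singleton_ne_empty _ hc.symm
      · rw [h, hd'] at hc
        exact Finset.singleton_ne_empty _ hc.symm
      · rw [h, he] at hc
        exact singleton_ne_univ _ hc.symm
    · obtain ⟨c', p', g, rfl, hE, hp', hg, hlink⟩ := hφ.edgesAt_inr H hl
      have hpp : p = p' := by
        rcases (hE.2.2.2 p).1 hp with h | h | h
        · rw [h, hd] at hc
          exact absurd hc.symm (Finset.singleton_ne_empty _)
        · exact h
        · rw [h, hg] at hc
          exact absurd hc.symm (singleton_ne_compl_singleton _ _)
      subst hpp
      obtain rfl : c = c' := by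
        rw [hc] at hp'
        simpa using hp'
      refine ⟨rfl, _, _, hE.perm₁, ?_⟩
      rw [hψ.dart, hψ.double _ _ _ hlink hg]
  · left
    rcases (hE.2.2.2 p).1 hp with rfl | rfl | rfl
    · obtain rfl : c = 0 := by
        rw [hc] at h₀
        simpa using h₀
      exact ⟨_, _, hE, by rw [hψ.single _ _ h₁, hψ.single _ _ h₂]; rfl⟩
    · obtain rfl : c = 1 := by
        rw [hc] at h₁
        simpa using h₁
      exact ⟨_, _, hE.perm₁, by rw [hψ.single _ _ h₀, hψ.single _ _ h₂]; rfl⟩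
    · obtain rfl : c = 2 := by
        rw [hc] at h₂
        simpa using h₂
      exact ⟨_, _, hE.perm₂.perm₁, by rw [hψ.single _ _ h₀, hψ.single _ _ h₁]; rfl⟩

end IsDartColoring

end Graph

namespace CoreItem

/-- The other two edges at an end of an edge of color `c` in `E₁` have suitable colors. -/
abbrev Fine (c m : ℕ) : Prop := m = 24 ∨ m = 7 - 2 ^ c

theorem cost_edge (c a b : ℕ) : (edge c).cost a b =
    (if Fine c (2 ^ a + 2 ^ midColor c a b) then 0 else 1) +
    (if Fine c (2 ^ b + 2 ^ midColor c a b) then 0 else 1) + if a = b then 0 else 1 := by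
  simp [cost, Bool.cond_eq_ite, Fine]

theorem cost_vertex_eq_zero {e x a b : ℕ} (h : (vertex e x).cost a b = 0) :
    2 ^ a + 2 ^ b = 2 ^ (7 - e) + 2 ^ x ∨ 2 ^ a + 2 ^ b = 7 - 2 ^ x := by
  simp [cost, Bool.cond_eq_ite] at h
  tauto

theorem Fine.eq_or_and {c m n : ℕ} (hc : c < 3) (hm : Fine c m) (hn : Fine c n) :
    m = n ∨ m &&& n = 0 := by
  rcases hm with rfl | rfl <;> rcases hn with rfl | rfl
  · exact .inl rfl
  · interval_cases c <;> exact .inr rfl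
  · interval_cases c <;> exact .inr rfl
  · exact .inl rfl

end CoreItem

/-! ### Charging the edges that are not normal to darts. -/

namespace Graph

variable {α β : Type*} {G : Graph α β} {M : Fin 3 → Set β}

namespace IsDartColoring

open CoreItem

variable {A : CoreDarts (Dart G M) (TripleEdge G M)} {N : Set (TripleEdge G M)}
  {x : TripleEdge G M → ℕ} {φ : Dart G M → ℕ} {ψ : β → Fin 5}

/-- The set of edges which are charged at `d`. -/
structure IsCharged (A : CoreDarts (Dart G M) (TripleEdge G M)) (N : Set (TripleEdge G M))
    (x : TripleEdge G M → ℕ) (φ : Dart G M → ℕ) (d : Dart G M) (T : Finset β) : Prop where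
  card_le : T.card ≤ charge A.σ A.τ (A.item N x) φ d
  dart : clash ((A.item N x (A.τ d)).others (φ (A.τ d)) (φ (A.σ (A.τ d))))
    ((A.item N x d).others (φ d) (φ (A.σ d))) ≠ 0 → d.1.2 ∈ T
  triple : ∀ e, A.label d = .inl e → (A.item N x d).cost (φ d) (φ (A.σ d)) ≠ 0 → e.1 ∈ T
  single : ∀ (c : Fin 3) p, A.label d = .inr (c : ℕ) → indices M p = {c} → G.Inc p d.1.1 →
    ¬ Fine c (2 ^ φ d + 2 ^ midColor c (φ d) (φ (A.σ d))) → p ∈ T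
  single' : ∀ (c : Fin 3) p, A.label d = .inr (c : ℕ) → indices M p = {c} → G.Inc p (A.σ d).1.1 →
    ¬ Fine c (2 ^ φ (A.σ d) + 2 ^ midColor c (φ d) (φ (A.σ d))) → p ∈ T
  double : ∀ (c : Fin 3) h, A.label d = .inr (c : ℕ) → indices M h = {c}ᶜ → G.Inc h d.1.1 →
    φ d ≠ φ (A.σ d) → h ∈ T

/-- The set is a union of at most singletons, one for each separate term of the charge. -/
theorem exists_isCharged (hφ : IsDartColoring A N x φ) (H : G.IsFactorTriple M) (d : Dart G M) :
    ∃ T, IsCharged A N x φ d T := by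
  classical
  have hcard : ∀ (P : Prop) [Decidable P] (a : β),
      (if P then ∅ else {a} : Finset β).card = if P then 0 else 1 := by
    intro P _ a
    split_ifs <;> rfl
  set k := clash ((A.item N x (A.τ d)).others (φ (A.τ d)) (φ (A.σ (A.τ d))))
    ((A.item N x d).others (φ d) (φ (A.σ d))) with hk
  have hkle : (if k = 0 then 0 else 1) ≤ k := by split_ifs <;> omega
  have hch : charge A.σ A.τ (A.item N x) φ d = (A.item N x d).cost (φ d) (φ (A.σ d)) + k := rfl
  rcases hl : A.label d with e | m
  · set l := (A.item N x d).cost (φ d) (φ (A.σ d)) with hl'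
    have hlle : (if l = 0 then 0 else 1) ≤ l := by split_ifs <;> omega
    refine ⟨(if k = 0 then ∅ else {d.1.2}) ∪ (if l = 0 then ∅ else {e.1}), ?_, ?_, ?_, ?_, ?_, ?_⟩
    · refine (Finset.card_union_le _ _).trans ?_
      rw [hcard, hcard, hch]
      omega
    · intro h
      rw [← hk] at h
      simp [h]
    · intro e' he' h
      rw [← hl'] at h
      rw [hl, Sum.inl.injEq] at he'
      simp [h, he']
    all_goals
      intro c p hc
      rw [hl] at hc
      cases hc
  · obtain ⟨c, p, g, rfl, hE, hp, hg, hlink⟩ := hφ.edgesAt_inr H hl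
    obtain ⟨c', p', g', hcc, hE', hp', -, -⟩ :=
      hφ.edgesAt_inr H ((A.label_σ d).trans hl)
    obtain rfl : c = c' := Fin.ext hcc
    refine ⟨(if k = 0 then ∅ else {d.1.2}) ∪
      ((if Fine c (2 ^ φ d + 2 ^ midColor c (φ d) (φ (A.σ d))) then ∅ else {p}) ∪
      (if Fine c (2 ^ φ (A.σ d) + 2 ^ midColor c (φ d) (φ (A.σ d))) then ∅ else {p'}) ∪
      (if φ d = φ (A.σ d) then ∅ else {g})), ?_, ?_, ?_, ?_, ?_, ?_⟩
    · have h1 := Finset.card_union_le (if k = 0 then ∅ else {d.1.2} : Finset β)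
        ((if Fine c (2 ^ φ d + 2 ^ midColor c (φ d) (φ (A.σ d))) then ∅ else {p}) ∪
        (if Fine c (2 ^ φ (A.σ d) + 2 ^ midColor c (φ d) (φ (A.σ d))) then ∅ else {p'}) ∪
        (if φ d = φ (A.σ d) then ∅ else {g}))
      have h2 := Finset.card_union_le
        ((if Fine c (2 ^ φ d + 2 ^ midColor c (φ d) (φ (A.σ d))) then ∅ else {p}) ∪
        (if Fine c (2 ^ φ (A.σ d) + 2 ^ midColor c (φ d) (φ (A.σ d))) then ∅ else {p'}))
        (if φ d = φ (A.σ d) then ∅ else {g} : Finset β)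
      have h3 := Finset.card_union_le
        (if Fine c (2 ^ φ d + 2 ^ midColor c (φ d) (φ (A.σ d))) then ∅ else {p} : Finset β)
        (if Fine c (2 ^ φ (A.σ d) + 2 ^ midColor c (φ d) (φ (A.σ d))) then ∅ else {p'})
      rw [hcard] at h1 h2
      rw [hcard, hcard] at h3
      rw [hch, A.item_inr hl, cost_edge]
      omega
    · intro h
      rw [← hk] at h
      simp [h]
    · intro e he
      rw [hl] at he
      cases he
    · intro c₁ p₁ hc₁ hp₁ hinc h
      rw [hl, Sum.inr.injEq] at hc₁
      obtain rfl : c = c₁ := Fin.ext hc₁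
      rw [H.eq_of_indices_eq_singleton hinc hE.inc₂ hp₁ hp, if_neg h]
      simp
    · intro c₁ p₁ hc₁ hp₁ hinc h
      rw [hl, Sum.inr.injEq] at hc₁
      obtain rfl : c = c₁ := Fin.ext hc₁
      rw [H.eq_of_indices_eq_singleton hinc hE'.inc₂ hp₁ hp', if_neg h]
      simp
    · intro c₁ h₁ hc₁ hh₁ hinc h
      rw [hl, Sum.inr.injEq] at hc₁
      obtain rfl : c = c₁ := Fin.ext hc₁
      rw [H.eq_of_indices_eq_compl hinc hE.inc₃ hh₁ hg, if_neg h]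
      simp

/-- An E₀ edge is charged at its own two darts. Any other edge that is not normal is charged to some
item, and an item has two darts exchanged by σ. -/
theorem exists_two_darts (hφ : IsDartColoring A N x φ) (H : G.IsFactorTriple M)
    (hψ : IsExtension A N φ ψ) {T : Dart G M → Finset β} (hT : ∀ d, IsCharged A N x φ d (T d))
    {g : β} (hg : g ∈ E(G)) (hn : ¬ G.IsNormalEdge ψ g) : ∃ d d', d ≠ d' ∧ g ∈ T d ∧ g ∈ T d' := by
  classical
  have hproper := hφ.isProperEdgeColoring H hψ
  obtain ⟨u, v, huv⟩ := G.exists_isLink_of_mem_edgeSet hg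
  have hcases : ∀ s : Finset (Fin 3), s = ∅ ∨ s = Finset.univ ∨ (∃ c, s = {c}) ∨
      ∃ c, s = {c}ᶜ := by decide
  rcases hcases (indices M g) with h | h | ⟨c, h⟩ | ⟨c, h⟩
  · have hclash : ∀ d : Dart G M, d.1.2 = g → g ∈ T d := by
      rintro d rfl
      refine (hT d).dart fun h0 ↦ hn ?_
      have h1 := hφ.seesMask_dart H hψ d
      have h2 := hφ.seesMask_dart H hψ (A.τ d)
      have h3 : (A.τ d).1.2 = d.1.2 := by rw [hφ.τ_eq]; rfl
      rw [h3] at h2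
      refine isNormalEdge_of_seesMask hproper ?_ h2 h1 (clash_eq_zero h0)
      rw [hφ.τ_eq]
      exact d.isLink_flip.symm
    refine ⟨⟨(u, g), huv.inc_left, h⟩, ⟨(v, g), huv.inc_right, h⟩, ?_, hclash _ rfl, hclash _ rfl⟩
    intro heq
    exact H.ne_of_isLink huv (congrArg (fun d : Dart G M ↦ d.1.1) heq)
  · let e : TripleEdge G M := ⟨g, hg, h⟩
    have hend : ∀ w, G.Inc g w → ∃ d : Dart G M, d.1.1 = w ∧ A.label d = .inl e := by
      intro w hw
      obtain ⟨d, d', hd, hopp⟩ := H.exists_dart_of_tripleEdge e hw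
      exact ⟨d, hd, (H.opposite_unique (hφ.opposite d) hopp).2⟩
    have hcharge : ∀ d, A.label d = .inl e → (A.item N x d).cost (φ d) (φ (A.σ d)) ≠ 0 →
        ∃ d d', d ≠ d' ∧ g ∈ T d ∧ g ∈ T d' := by
      intro d hd h0
      have hd' : A.label (A.σ d) = .inl e := (A.label_σ d).trans hd
      refine ⟨d, A.σ d, (A.σ_ne d).symm, (hT d).triple e hd h0, (hT _).triple e hd' ?_⟩
      rwa [A.item_inl hd', A.σ_invol, cost_comm, ← A.item_inl hd]
    obtain ⟨d, rfl, hd⟩ := hend u huv.inc_left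
    obtain ⟨d', rfl, hd'⟩ := hend v huv.inc_right
    by_cases h0 : (A.item N x d).cost (φ d) (φ (A.σ d)) = 0
    · by_cases h0' : (A.item N x d').cost (φ d') (φ (A.σ d')) = 0
      · refine absurd (isNormalEdge_of_seesMask hproper huv (hφ.seesMask_triple H hψ hd)
          (hφ.seesMask_triple H hψ hd') ?_) hn
        rw [A.item_inl hd] at h0
        rw [A.item_inl hd'] at h0'
        have hx := hφ.target_lt e
        generalize x e = y at *
        rcases cost_vertex_eq_zero h0 with h1 | h1 <;> rcases cost_vertex_eq_zero h0' with h2 | h2 <;>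
          rw [h1, h2]
        · exact .inl rfl
        · right
          split_ifs <;> interval_cases y <;> rfl
        · right
          split_ifs <;> interval_cases y <;> rfl
        · exact .inl rfl
      · exact hcharge d' hd' h0'
    · exact hcharge d hd h0
  · have hcharge : ∀ d : Dart G M, G.Inc g d.1.1 → A.label d = .inr (c : ℕ) →
        ¬ Fine c (2 ^ φ d + 2 ^ midColor c (φ d) (φ (A.σ d))) →
        ∃ d d', d ≠ d' ∧ g ∈ T d ∧ g ∈ T d' := by
      intro d hd hl hf
      refine ⟨d, A.σ d, (A.σ_ne d).symm, (hT d).single c g hl h hd hf,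
        (hT _).single' c g ((A.label_σ d).trans hl) h ?_ ?_⟩
      · rwa [A.σ_invol]
      · rwa [A.σ_invol, midColor_comm]
    have hend : ∀ w, G.Inc g w → (∃ d d', d ≠ d' ∧ g ∈ T d ∧ g ∈ T d') ∨
        ∃ m, G.SeesMask ψ w g m ∧ Fine c m := by
      intro w hw
      rcases hφ.seesMask_single H hψ hw h with h1 | ⟨d, rfl, hl, h1⟩
      · exact .inr ⟨_, h1, .inr rfl⟩
      · by_cases hf : Fine c (2 ^ φ d + 2 ^ midColor c (φ d) (φ (A.σ d)))
        · exact .inr ⟨_, h1, hf⟩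
        · exact .inl (hcharge d hw hl hf)
    rcases hend u huv.inc_left with h1 | ⟨m, hm, hfm⟩
    · exact h1
    rcases hend v huv.inc_right with h1 | ⟨n, hn', hfn⟩
    · exact h1
    exact absurd (isNormalEdge_of_seesMask hproper huv hm hn' (hfm.eq_or_and c.2 hfn)) hn
  · obtain ⟨d, rfl⟩ := H.exists_dart huv.inc_left h
    obtain ⟨d', rfl, hopp⟩ := H.exists_opposite_of_isLink huv h
    obtain ⟨rfl, hl⟩ := H.opposite_unique (hφ.opposite d) hopp
    have hne : φ d ≠ φ (A.σ d) := by
      intro heq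
      refine hn (isNormalEdge_of_seesMask hproper huv (hψ.seesMask_double H huv.inc_left h)
        (hψ.seesMask_double H huv.inc_right h) ?_)
      rw [heq]
      exact .inl rfl
    refine ⟨d, A.σ d, (A.σ_ne d).symm, (hT d).double c g hl h huv.inc_left hne,
      (hT _).double c g ((A.label_σ d).trans hl) h huv.inc_right ?_⟩
    rw [A.σ_invol]
    exact hne.symm

end IsDartColoring

theorem IsFactorTriple.finite_dart (hV : V(G).Finite) (hE : E(G).Finite) : Finite (Dart G M) :=
  Set.Finite.to_subtype <| (hV.prod hE).subset fun _ hp ↦ ⟨hp.1.vertex_mem, hp.1.edge_mem⟩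

/-- At most as many edges are not normal as there are edges in none of the three 1-factors. -/
theorem IsFactorTriple.exists_coloring (H : G.IsFactorTriple M) (hV : V(G).Finite)
    (hE : E(G).Finite) : ∃ ψ : β → Fin 5, G.IsProperEdgeColoring ψ ∧
      {e ∈ E(G) | ¬ G.IsNormalEdge ψ e}.ncard ≤ {e ∈ E(G) | indices M e = ∅}.ncard := by
  classical
  have := IsFactorTriple.finite_dart (M := M) hV hE
  have := Fintype.ofFinite (Dart G M)
  have : Finite (TripleEdge G M) := Set.Finite.to_subtype (hE.subset fun _ he ↦ he.1)
  obtain ⟨A, hτ, hσ⟩ := H.exists_coreDarts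
  obtain ⟨N, x, φ, hx, hφτ, hval, hsum⟩ := A.exists_coloring
  have hφ : IsDartColoring A N x φ := ⟨hτ, hσ, hx, fun d ↦ by rw [← hτ]; exact hφτ d, hval⟩
  obtain ⟨ψ, hψ⟩ := hφ.exists_isExtension H
  choose T hT using hφ.exists_isCharged H
  refine ⟨ψ, hφ.isProperEdgeColoring H hψ, ?_⟩
  set B := (hE.subset (Set.sep_subset E(G) fun e ↦ ¬ G.IsNormalEdge ψ e)).toFinset with hB
  set Z := (hE.subset (Set.sep_subset E(G) fun e ↦ indices M e = ∅)).toFinset with hZ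
  rw [Set.ncard_eq_toFinset_card _ (hE.subset (Set.sep_subset _ _)),
    Set.ncard_eq_toFinset_card _ (hE.subset (Set.sep_subset _ _)), ← hB, ← hZ]
  have h1 : B.card * 2 ≤ ∑ g ∈ B, (Finset.univ.filter fun d ↦ g ∈ T d).card := by
    rw [← smul_eq_mul]
    refine Finset.card_nsmul_le_sum _ _ _ fun g hg ↦ ?_
    have hg' : g ∈ E(G) ∧ ¬ G.IsNormalEdge ψ g := by simpa [hB] using hg
    obtain ⟨d, d', hne, hd, hd'⟩ := hφ.exists_two_darts H hψ hT hg'.1 hg'.2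
    exact Finset.one_lt_card.2 ⟨d, by simpa using hd, d', by simpa using hd', hne⟩
  have h2 : ∑ g ∈ B, (Finset.univ.filter fun d ↦ g ∈ T d).card =
      ∑ d, (B.filter fun g ↦ g ∈ T d).card :=
    Finset.sum_card_bipartiteAbove_eq_sum_card_bipartiteBelow fun g d ↦ g ∈ T d
  have h3 : ∑ d, (B.filter fun g ↦ g ∈ T d).card ≤ ∑ d, CoreItem.charge A.σ A.τ (A.item N x) φ d := by
    refine Finset.sum_le_sum fun d _ ↦ (Finset.card_le_card ?_).trans (hT d).card_le
    intro g hg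
    exact (Finset.mem_filter.1 hg).2
  have h4 : Fintype.card (Dart G M) ≤ 2 * Z.card := by
    rw [← Finset.card_univ]
    refine Finset.card_le_mul_card_image_of_maps_to (f := fun d : Dart G M ↦ d.1.2) ?_ 2 ?_
    · intro d _
      simpa [hZ] using ⟨d.2.1.edge_mem, d.2.2⟩
    · intro g _
      by_cases h : ∃ d : Dart G M, d.1.2 = g
      · obtain ⟨d, rfl⟩ := h
        refine (Finset.card_le_card (t := {d, d.flip}) ?_).trans Finset.card_le_two
        intro d' hd'
        rw [Finset.mem_filter] at hd'
        simpa using d.eq_or_eq_flip hd'.2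
      · rw [Finset.filter_eq_empty_iff.2 fun d _ hd ↦ h ⟨d, hd⟩]
        simp
  omega

end Graph

/-! ### Petersen's theorem by way of Tutte's theorem. -/

namespace Graph

variable {α β : Type*} {G : Graph α β}

/-- The edges which join `K` to its complement. -/
def cut (G : Graph α β) (K : Set α) : Set β := {e | ∃ x ∈ K, ∃ y ∉ K, G.IsLink e x y}

theorem cut_subset (K : Set α) : G.cut K ⊆ E(G) := fun _ ⟨_, _, _, _, h⟩ ↦ h.edge_mem

/-- A walk avoiding the only edge of the cut cannot leave `K`, so this edge would be a bridge. -/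
theorem Bridgeless.ncard_cut_ne_one (hb : G.Bridgeless) (K : Set α) : (G.cut K).ncard ≠ 1 := by
  intro h
  obtain ⟨e, he⟩ := Set.ncard_eq_one.1 h
  have hmem : e ∈ G.cut K := by rw [he]; rfl
  obtain ⟨x, hx, y, hy, hxy⟩ := hmem
  refine hb e hxy.edge_mem ⟨x, y, hxy, fun hreach ↦ hy ?_⟩
  have key : ∀ z, (G.deleteEdges {e}).Reachable x z → z ∈ K := by
    intro z hz
    unfold Reachable at hz
    induction hz with
    | refl => exact hx
    | @tail b c _ hbc ih =>
      by_contra hc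
      obtain ⟨f, hf⟩ := hbc
      rw [deleteEdges_isLink] at hf
      have : f ∈ G.cut K := ⟨b, ih, c, hc, hf.1⟩
      rw [he] at this
      exact hf.2 this
  exact key y hreach

theorem cut_singleton (x : α) : G.cut {x} = G.incidenceSet x \ G.loopSet x := by
  ext e
  constructor
  · rintro ⟨_, rfl, y, hy, h⟩
    exact ⟨h.inc_left, fun hl ↦ hy (h.right_unique hl)⟩
  · rintro ⟨⟨y, h⟩, hl⟩
    refine ⟨x, rfl, y, ?_, h⟩
    rintro rfl
    exact hl h

/-- A loop uses two of the three degrees, which leaves a single edge in the cut around its vertex.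
-/
theorem IsCubic.not_isLoopAt (hc : G.IsCubic) (hb : G.Bridgeless) (hE : E(G).Finite) (e : β)
    (x : α) : ¬ G.IsLoopAt e x := by
  intro h
  have hdeg := hc x h.vertex_mem
  unfold degree at hdeg
  have hsub := G.loopSet_subset_incidenceSet x
  have hI : (G.incidenceSet x).Finite := hE.subset (G.incidenceSet_subset_edgeSet x)
  have hle := Set.ncard_le_ncard hsub hI
  have hpos : 0 < (G.loopSet x).ncard := (Set.ncard_pos (hI.subset hsub)).2 ⟨e, h⟩
  refine hb.ncard_cut_ne_one {x} ?_
  rw [cut_singleton, Set.ncard_sdiff hsub (hI.subset hsub)]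
  omega

theorem IsCubic.ncard_incidenceSet (hc : G.IsCubic) (hb : G.Bridgeless) (hE : E(G).Finite)
    {x : α} (hx : x ∈ V(G)) : (G.incidenceSet x).ncard = 3 := by
  have hdeg := hc x hx
  have : G.loopSet x = ∅ :=
    Set.eq_empty_of_forall_notMem fun e he ↦ hc.not_isLoopAt hb hE e x he
  rwa [degree, this, Set.ncard_empty, add_zero] at hdeg

/-- An odd set of vertices has an odd cut. -/
theorem IsCubic.odd_ncard_cut (hc : G.IsCubic) (hb : G.Bridgeless) (hE : E(G).Finite)
    {K : Set α} (hKV : K ⊆ V(G)) (hK : Odd K.ncard) : Odd (G.cut K).ncard := by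
  classical
  have hfin : K.Finite := Set.finite_of_ncard_pos hK.pos
  have hcount := Finset.sum_card_bipartiteAbove_eq_sum_card_bipartiteBelow
    (s := hfin.toFinset) (t := hE.toFinset) fun x e ↦ G.Inc e x
  have h1 : ∀ x ∈ hfin.toFinset, (hE.toFinset.bipartiteAbove (fun x e ↦ G.Inc e x) x).card = 3 := by
    intro x hx
    rw [← hc.ncard_incidenceSet hb hE (hKV (hfin.mem_toFinset.1 hx)), ← Set.ncard_coe_finset]
    congr 1
    ext e
    simp only [Finset.coe_bipartiteAbove, Set.Finite.mem_toFinset, Set.mem_ofPred_eq,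
      mem_incidenceSet]
    exact ⟨fun h ↦ h.2, fun h ↦ ⟨h.edge_mem, h⟩⟩
  rw [Finset.sum_congr rfl h1, Finset.sum_const, smul_eq_mul, ← Set.ncard_eq_toFinset_card K hfin] at hcount
  have h2 : Odd (K.ncard * 3) := hK.mul (by decide)
  -- Counting incidences with `K` modulo 2, an edge matters only if exactly one of its ends is in
  -- `K`, that is, if it lies in the cut.
  rw [hcount, Finset.odd_sum_iff_odd_card_odd] at h2
  convert h2 using 1
  rw [← Set.ncard_coe_finset]
  congr 1
  ext e
  simp only [Finset.coe_filter, Set.Finite.mem_toFinset, Set.mem_ofPred_eq]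
  have hend : ∀ x y, G.IsLink e x y →
      hfin.toFinset.bipartiteBelow (fun x e ↦ G.Inc e x) e = ({x, y} : Finset α).filter (· ∈ K) := by
    intro x y h
    ext z
    simp only [Finset.mem_bipartiteBelow, Set.Finite.mem_toFinset, Finset.mem_filter,
      Finset.mem_insert, Finset.mem_singleton]
    constructor
    · rintro ⟨hz, hi⟩
      exact ⟨hi.eq_or_eq_of_isLink h, hz⟩
    · rintro ⟨rfl | rfl, hz⟩
      exacts [⟨hz, h.inc_left⟩, ⟨hz, h.inc_right⟩]
  constructor
  · rintro ⟨x, hx, y, hy, h⟩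
    refine ⟨h.edge_mem, ?_⟩
    rw [hend x y h, Finset.filter_insert, Finset.filter_singleton, if_pos hx, if_neg hy]
    simp
  · rintro ⟨he, hodd⟩
    obtain ⟨x, y, h⟩ := G.exists_isLink_of_mem_edgeSet he
    have hxy : x ≠ y := by
      rintro rfl
      exact hc.not_isLoopAt hb hE e x h
    rw [hend x y h, Finset.filter_insert, Finset.filter_singleton] at hodd
    by_cases hx : x ∈ K <;> by_cases hy : y ∈ K
    · rw [if_pos hx, if_pos hy, Finset.card_pair hxy] at hodd
      exact absurd hodd (by decide)
    · exact ⟨x, hx, y, hy, h⟩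
    · exact ⟨y, hy, x, hx, h.symm⟩
    · rw [if_neg hx, if_neg hy] at hodd
      exact absurd hodd (by simp)

theorem IsCubic.three_le_ncard_cut (hc : G.IsCubic) (hb : G.Bridgeless) (hE : E(G).Finite)
    {K : Set α} (hKV : K ⊆ V(G)) (hK : Odd K.ncard) : 3 ≤ (G.cut K).ncard := by
  obtain ⟨k, hk⟩ := hc.odd_ncard_cut hb hE hKV hK
  have := hb.ncard_cut_ne_one K
  omega

/-- Each odd component left by u sends at least three edges to u, different components send
different edges, and u receives at most three edges per vertex. -/
theorem IsCubic.not_isTutteViolator (hc : G.IsCubic) (hb : G.Bridgeless) (hV : V(G).Finite)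
    (hE : E(G).Finite) (u : Set V(G)) : ¬ G.toSimpleGraph.IsTutteViolator u := by
  classical
  have : Finite V(G) := hV.to_subtype
  unfold SimpleGraph.IsTutteViolator
  rw [not_lt]
  set S := ((⊤ : G.toSimpleGraph.Subgraph).deleteVerts u) with hS
  let K : S.coe.ConnectedComponent → Set α := fun c ↦ (fun v : S.verts ↦ (v : V(G)).1) '' c.supp
  have hinj : Function.Injective fun v : S.verts ↦ (v : V(G)).1 :=
    Subtype.val_injective.comp Subtype.val_injective
  have hKV : ∀ c, K c ⊆ V(G) := by
    rintro c _ ⟨v, -, rfl⟩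
    exact v.1.2
  have hcut : ∀ c, ∀ e ∈ G.cut (K c), ∃ x : S.verts, x ∈ c.supp ∧ ∃ y ∈ u, G.IsLink e x.1 y := by
    rintro c e ⟨_, ⟨x, hx, rfl⟩, y, hy, h⟩
    refine ⟨x, hx, ⟨y, h.right_mem⟩, ?_, h⟩
    by_contra hyu
    have hyS : (⟨y, h.right_mem⟩ : V(G)) ∈ S.verts := by simp [hS, hyu]
    have hadj : S.coe.Adj x ⟨_, hyS⟩ := by
      have hxS : x.1 ∈ (⊤ : G.toSimpleGraph.Subgraph).verts \ u := x.2
      refine SimpleGraph.Subgraph.deleteVerts_adj.2 ⟨hxS.1, hxS.2, by simp, hyu, ?_⟩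
      rw [SimpleGraph.Subgraph.top_adj, toSimpleGraph_adj]
      refine ⟨fun hxy ↦ ?_, e, h⟩
      have hxy' : x.1.1 = y := congrArg Subtype.val hxy
      exact hc.not_isLoopAt hb hE e y (hxy' ▸ h)
    refine hy ⟨⟨_, hyS⟩, ?_, rfl⟩
    rw [SimpleGraph.ConnectedComponent.mem_supp_iff] at hx ⊢
    rw [← hx]
    exact SimpleGraph.ConnectedComponent.connectedComponentMk_eq_of_adj hadj.symm
  have hcutfin : ∀ c, (G.cut (K c)).Finite := fun c ↦ hE.subset (cut_subset _)
  have hdisj : ∀ c c', c ≠ c' → Disjoint (hcutfin c).toFinset (hcutfin c').toFinset := by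
    intro c c' hne
    rw [Finset.disjoint_left]
    intro e he he'
    rw [Set.Finite.mem_toFinset] at he he'
    obtain ⟨x, hx, y, hy, h⟩ := hcut c e he
    obtain ⟨x', hx', y', hy', h'⟩ := hcut c' e he'
    have hxu : x.1 ∉ u := x.2.2
    have hxx : x.1 = x'.1 := by
      rcases h.left_eq_or_eq h' with h1 | h1
      · exact Subtype.ext h1
      · exact absurd (Subtype.ext h1 ▸ hy') hxu
    have hxx' : x = x' := Subtype.ext hxx
    rw [SimpleGraph.ConnectedComponent.mem_supp_iff] at hx hx'
    exact hne (by rw [← hx, ← hx', hxx'])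
  have hufin : u.Finite := Set.toFinite u
  have hOfin : S.coe.oddComponents.Finite := Set.toFinite _
  have hIfin : ∀ x, (G.incidenceSet x).Finite := fun x ↦
    hE.subset (G.incidenceSet_subset_edgeSet x)
  have h1 : hOfin.toFinset.card * 3 ≤ (hOfin.toFinset.biUnion fun c ↦ (hcutfin c).toFinset).card := by
    rw [Finset.card_biUnion fun c _ c' _ h ↦ hdisj c c' h, ← smul_eq_mul]
    refine Finset.card_nsmul_le_sum _ _ _ fun c hcO ↦ ?_
    rw [← Set.ncard_eq_toFinset_card _ (hcutfin c)]
    refine hc.three_le_ncard_cut hb hE (hKV c) ?_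
    rw [Set.ncard_image_of_injective _ hinj]
    exact hOfin.mem_toFinset.1 hcO
  have h2 : (hOfin.toFinset.biUnion fun c ↦ (hcutfin c).toFinset) ⊆
      hufin.toFinset.biUnion fun x ↦ (hIfin x).toFinset := by
    intro e he
    obtain ⟨c, -, hc⟩ := Finset.mem_biUnion.1 he
    obtain ⟨x, -, y, hy, h⟩ := hcut c e ((hcutfin c).mem_toFinset.1 hc)
    exact Finset.mem_biUnion.2 ⟨y, hufin.mem_toFinset.2 hy, (hIfin _).mem_toFinset.2 h.inc_right⟩
  have h3 : (hufin.toFinset.biUnion fun x ↦ (hIfin x).toFinset).card ≤ hufin.toFinset.card * 3 := by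
    refine Finset.card_biUnion_le_card_mul _ _ _ fun x _ ↦ ?_
    rw [← Set.ncard_eq_toFinset_card _ (hIfin x)]
    exact (hc.ncard_incidenceSet hb hE x.2).le
  have h4 := Finset.card_le_card h2
  rw [Set.ncard_eq_toFinset_card _ hufin, Set.ncard_eq_toFinset_card _ hOfin]
  omega

/-- **Petersen's theorem**: a bridgeless cubic graph has a 1-factor. -/
theorem IsCubic.exists_isOneFactor (hc : G.IsCubic) (hb : G.Bridgeless) (hV : V(G).Finite)
    (hE : E(G).Finite) : ∃ M, G.IsOneFactor M := by
  have : Fintype V(G) := @Fintype.ofFinite _ hV.to_subtype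
  obtain ⟨P, hP⟩ := SimpleGraph.tutte.2 (hc.not_isTutteViolator hb hV hE)
  rw [SimpleGraph.Subgraph.isPerfectMatching_iff] at hP
  -- Among parallel edges one is selected for each matched pair.
  have hedge : ∀ z : P.edgeSet, ∃ e, ∀ x y, z.1 = s(x, y) → G.IsLink e x y := by
    rintro ⟨z, hz⟩
    induction z using Sym2.ind with
    | _ a b =>
      obtain ⟨-, e, he⟩ := P.adj_sub hz
      refine ⟨e, fun x y hxy ↦ ?_⟩
      rcases Sym2.eq_iff.1 hxy with ⟨rfl, rfl⟩ | ⟨rfl, rfl⟩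
      exacts [he, he.symm]
  choose f hf using hedge
  have hex : ∀ z : P.edgeSet, ∃ x y, z.1 = s(x, y) ∧ P.Adj x y := by
    rintro ⟨z, hz⟩
    induction z using Sym2.ind with
    | _ a b => exact ⟨a, b, rfl, hz⟩
  refine ⟨Set.range f, ?_, ?_, fun e _ x ↦ hc.not_isLoopAt hb hE e x⟩
  · rintro _ ⟨z, rfl⟩
    obtain ⟨x, y, hz, -⟩ := hex z
    exact (hf z x y hz).edge_mem
  · intro x hx
    obtain ⟨y, hy, huniq⟩ := hP ⟨x, hx⟩
    refine ⟨f ⟨s(⟨x, hx⟩, y), hy⟩, ⟨⟨_, rfl⟩, (hf _ ⟨x, hx⟩ y rfl).inc_left⟩, ?_⟩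
    rintro _ ⟨⟨z, rfl⟩, hinc⟩
    obtain ⟨a, b, hz, hab⟩ := hex z
    congr 1
    refine Subtype.ext ?_
    rw [hz]
    rcases hinc.eq_or_eq_of_isLink (hf z a b hz) with rfl | rfl
    · rw [huniq b hab]
    · rw [huniq a hab.symm, Sym2.eq_swap]

end Graph

theorem theorem1p4 {α β : Type*} (G : Graph α β) (hV : V(G).Finite) (hE : E(G).Finite)
    (hcubic : G.IsCubic) (hbridge : G.Bridgeless) :
    ∃ φ : β → Fin 5, G.IsProperEdgeColoring φ ∧
      (E(G).ncard : ℤ) - (G.mu3 : ℤ) ≤ ({e ∈ E(G) | G.IsNormalEdge φ e}.ncard : ℤ) := by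
  obtain ⟨M, hM⟩ := hcubic.exists_isOneFactor hbridge hV hE
  -- The infimum is attained only because some triple exists; three copies of one 1-factor suffice.
  have hcore : G.HasCore G.mu3 := Nat.sInf_mem (s := {k | G.HasCore k}) ⟨_, M, M, M, hM, hM, hM, rfl⟩
  obtain ⟨M₁, M₂, M₃, h₁, h₂, h₃, hk⟩ := hcore
  have H : G.IsFactorTriple ![M₁, M₂, M₃] :=
    ⟨hcubic.not_isLoopAt hbridge hE, fun x hx ↦ hcubic.ncard_incidenceSet hbridge hE hx, fun i ↦ by
      fin_cases i
      exacts [h₁, h₂, h₃]⟩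
  obtain ⟨ψ, hψ, hle⟩ := H.exists_coloring hV hE
  refine ⟨ψ, hψ, ?_⟩
  have hset : {e ∈ E(G) | Graph.indices ![M₁, M₂, M₃] e = ∅} = E(G) \ (M₁ ∪ M₂ ∪ M₃) := by
    ext e
    simp only [Set.mem_ofPred_eq, Set.mem_sdiff, Set.mem_union, Finset.eq_empty_iff_forall_notMem,
      Graph.mem_indices, Fin.forall_fin_succ]
    simp [and_assoc]
  rw [hset, hk] at hle
  have hsum : {e ∈ E(G) | G.IsNormalEdge ψ e}.ncard + {e ∈ E(G) | ¬ G.IsNormalEdge ψ e}.ncard =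
      E(G).ncard := by
    rw [← Set.ncard_union_eq ?_ (hE.subset (Set.sep_subset _ _)) (hE.subset (Set.sep_subset _ _))]
    · congr 1
      ext e
      simp only [Set.mem_union, Set.mem_ofPred_eq]
      tauto
    · rw [Set.disjoint_left]
      rintro e he he'
      exact he'.2 he.2
  omega
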